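/- For $\gamma\in\mathbb R$, a positive sequence $(v_n)_{n\ge1}$ is said to be in $\mathcal{GS}(\gamma)$ if $\lim_{n\to\infty} n\,[1-v_{n-1}/v_n]=\gamma$. Let $(X_n,Y_n)_{n\ge 1}$ be i.i.d. pairs of real random variables with joint density $g(s,t)$. Put $f(s)=\int_{\mathbb R} g(s,t)\,dt$ (the density of $X$), $\mathbb E[Y^q|X=s]=f(s)^{-1}\int_{\mathbb R} t^q g(s,t)\,dt$, $r(s)=\mathbb E[Y|X=s]$ and $a(s)=r(s)f(s)$. Fix $x\in\mathbb R$ with $f(x)>0$. Let $K:\mathbb R\to\mathbb R$ be a kernel, $(\beta_n)_{n\ge1}$ and $(\gamma_n)_{n\ge1}$ stepsizes and $(h_n)_{n\ge1}$ a bandwidth, and assume: (A1) $K$ is continuous and bounded, $\int K(z)\,dz=1$, $\int zK(z)\,dz=0$, and $z\mapsto z^2K(z)$ is integrable. (A2) i) $(\beta_n)\in\mathcal{GS}(-\beta)$ with $\beta\in(1/2,1]$; ii) $(h_n)\in\mathcal{GS}(-a)$ with $a\in(0,1)$; iii) $\lim_{n\to\infty} n\beta_n$ exists in $\left(\min\{2a,(\beta-a)/2\},\infty\right]$.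 (A3) i) $s\mapsto g(s,t)$ is twice continuously differentiable for every $t$. ii) For $q\in\{0,1,2\}$, $s\mapsto\int t^q g(s,t)\,dt$ is a bounded function continuous at $s=x$; for $q\in[2,3]$, $s\mapsto\int|t|^q g(s,t)\,dt$ is a bounded function. iii) For $q\in\{0,1\}$, $\int|t|^q\left|\frac{\partial g}{\partial s}(x,t)\right|dt<\infty$, and $s\mapsto\int t^q\frac{\partial^2 g}{\partial s^2}(s,t)\,dt$ is a bounded function continuous at $s=x$. Moreover, the functions $f$ and $a$ are twice differentiable at $x$. Define $a_0(x)=f_0(x)=0$ and, for $n\ge1$, $$a_n(x)=(1-\beta_n)a_{n-1}(x)+\beta_nh_n^{-1}Y_nK\!\left(h_n^{-1}(x-X_n)\right),\qquad f_n(x)=(1-\gamma_n)f_{n-1}(x)+\gamma_nh_n^{-1}K\!\left(h_n^{-1}(x-X_n)\right),$$ and let $r_n(x)=a_n(x)/f_n(x)$ if $f_n(x)\ne0$ and $r_n(x)=0$ otherwise. Let $\xi=\lim_{n\to\infty}(n\beta_n)^{-1}$, $R(K)=\int K^2(z)\,dz$, $\mu_2(K)=\int z^2K(z)\,dz$, and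 $$B^{(2)}_{a,\xi}(x)=\frac1{2f(x)}\left(\frac{a^{(2)}(x)}{1-2a\xi}-\frac{1-a}{1-3a}\,r(x)f^{(2)}(x)\right)\mu_2(K),$$ $$V^{(2)}_{a,\xi,\beta}(x)=\left\{\frac{\mathbb E[Y^2|X=x]}{(2-(\beta-a)\xi)f(x)}-(1-a)\xi\,\frac{r^2(x)}{f(x)}\right\}R(K).$$ Suppose that $\gamma_n=(1-a)n^{-1}$ for all $n\ge1$. Then: 1. If $\beta_nh_n^{-1}\to0$ and there exists $c\ge0$ such that $\beta_n^{-1}h_n^5\to c$, then $V^{(2)}_{a,\xi,\beta}(x)\ge 0$ and $$\sqrt{\beta_n^{-1}h_n}\,\left(r_n(x)-r(x)\right)\ \xrightarrow{\ \mathcal D\ }\ \mathcal N\!\left(\sqrt c\,B^{(2)}_{a,\xi}(x),\,V^{(2)}_{a,\xi,\beta}(x)\right),$$ where the mean is $0$ when $c=0$. 2. If $\beta_n^{-1}h_n^5\to\infty$, then $$h_n^{-2}\left(r_n(x)-r(x)\right)\ \xrightarrow{\ \mathbb P\ }\ B^{(2)}_{a,\xi}(x).$$ -/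

import Mathlib

open MeasureTheory ProbabilityTheory Filter Topology

noncomputable section

namespace SemiRecursive

/-- The class `GS(γ)` of regularly varying sequences: `(v_n)_{n ≥ 1}` is positive and
`n * (1 - v_{n-1} / v_n) → γ`. The value `v 0` plays no role. -/
def GS (v : ℕ → ℝ) (γ : ℝ) : Prop :=
  (∀ n : ℕ, 1 ≤ n → 0 < v n) ∧
    Tendsto (fun n : ℕ => (n : ℝ) * (1 - v (n - 1) / v n)) atTop (𝓝 γ)

/-! ### The estimators

The stepsizes, the bandwidth and the sample are indexed by `n ≥ 1`; their values at `0` are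
never used. -/

/-- The recursive estimator `a_n(x)` of `a(x) = E(Y | X = x) f(x)`, with `a_0(x) = 0`. -/
def aEst {Ω : Type*} (K : ℝ → ℝ) (stepβ h : ℕ → ℝ) (X Y : ℕ → Ω → ℝ) (x : ℝ) : ℕ → Ω → ℝ
  | 0, _ => 0
  | n + 1, ω => (1 - stepβ (n + 1)) * aEst K stepβ h X Y x n ω +
      stepβ (n + 1) * (h (n + 1))⁻¹ * Y (n + 1) ω * K ((h (n + 1))⁻¹ * (x - X (n + 1) ω))

/-- The recursive estimator `f_n(x)` of the density `f(x)` of `X`, with `f_0(x) = 0`. -/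
def fEst {Ω : Type*} (K : ℝ → ℝ) (stepγ h : ℕ → ℝ) (X : ℕ → Ω → ℝ) (x : ℝ) : ℕ → Ω → ℝ
  | 0, _ => 0
  | n + 1, ω => (1 - stepγ (n + 1)) * fEst K stepγ h X x n ω +
      stepγ (n + 1) * (h (n + 1))⁻¹ * K ((h (n + 1))⁻¹ * (x - X (n + 1) ω))

open Classical in
/-- The semi-recursive estimator `r_n(x)` of the regression function. -/
def rEst {Ω : Type*} (K : ℝ → ℝ) (stepγ stepβ h : ℕ → ℝ) (X Y : ℕ → Ω → ℝ) (x : ℝ)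
    (n : ℕ) (ω : Ω) : ℝ :=
  if fEst K stepγ h X x n ω ≠ 0 then aEst K stepβ h X Y x n ω / fEst K stepγ h X x n ω else 0

/-! ### Quantities attached to the joint density `g` of `(X, Y)` and to the kernel -/

/-- The density `f` of `X`. -/
def marginal (g : ℝ → ℝ → ℝ) (s : ℝ) : ℝ := ∫ t, g s t

/-- `E[Y ^ q | X = s]`, computed from the joint density. -/
def condMoment (g : ℝ → ℝ → ℝ) (q : ℕ) (s : ℝ) : ℝ := (∫ t, t ^ q * g s t) / marginal g s

/-- The regression function `r(s) = E[Y | X = s]`. -/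
def regFun (g : ℝ → ℝ → ℝ) (s : ℝ) : ℝ := condMoment g 1 s

/-- The function `a(s) = E[Y | X = s] f(s)`. -/
def aFun (g : ℝ → ℝ → ℝ) (s : ℝ) : ℝ := regFun g s * marginal g s

/-- `φ` is twice differentiable at `x`. -/
def TwiceDifferentiableAt (φ : ℝ → ℝ) (x : ℝ) : Prop :=
  (∀ᶠ s in 𝓝 x, DifferentiableAt ℝ φ s) ∧ DifferentiableAt ℝ (deriv φ) x

/-- `R(K) = ∫ K²`. -/
def kernelR (K : ℝ → ℝ) : ℝ := ∫ z, K z ^ 2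

/-- `μ_j(K) = ∫ z ^ j K(z) dz`. -/
def kernelMoment (K : ℝ → ℝ) (j : ℕ) : ℝ := ∫ z, z ^ j * K z

/-- The asymptotic bias `B^{(2)}_{a,ξ}(x)`. -/
def biasB (K : ℝ → ℝ) (g : ℝ → ℝ → ℝ) (a ξ x : ℝ) : ℝ :=
  1 / (2 * marginal g x) *
    (deriv (deriv (aFun g)) x / (1 - 2 * a * ξ) -
      (1 - a) / (1 - 3 * a) * (regFun g x * deriv (deriv (marginal g)) x)) *
    kernelMoment K 2

/-- The asymptotic variance `V^{(2)}_{a,ξ,β}(x)`. -/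
def varV (K : ℝ → ℝ) (g : ℝ → ℝ → ℝ) (a ξ β x : ℝ) : ℝ :=
  (condMoment g 2 x / ((2 - (β - a) * ξ) * marginal g x) -
      (1 - a) * ξ * (regFun g x ^ 2 / marginal g x)) *
    kernelR K

/-! ### The assumptions -/

/-- The assumptions on the kernel. -/
structure KernelAssumption (K : ℝ → ℝ) : Prop where
  continuous : Continuous K
  bounded : ∃ M : ℝ, ∀ z, |K z| ≤ M
  integrable : Integrable K
  integral_eq_one : ∫ z, K z = 1
  integrable_one : Integrable (fun z => z * K z)
  integral_one : ∫ z, z * K z = 0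
  integrable_two : Integrable (fun z => z ^ 2 * K z)

/-- The assumptions on the stepsize `(β_n)` and on the bandwidth `(h_n)`. -/
structure StepAssumption (stepβ h : ℕ → ℝ) (β a : ℝ) : Prop where
  gs_step : GS stepβ (-β)
  β_mem : β ∈ Set.Ioc (1 / 2 : ℝ) 1
  gs_bandwidth : GS h (-a)
  a_mem : a ∈ Set.Ioo (0 : ℝ) 1
  lim_step : ∃ L : EReal, Tendsto (fun n : ℕ => (((n : ℝ) * stepβ n : ℝ) : EReal)) atTop (𝓝 L) ∧
    ((min (2 * a) ((β - a) / 2) : ℝ) : EReal) < L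

/-- The assumptions on the joint density `g` at the point `x`. Derivatives are with respect to
the first variable. -/
structure DensityAssumption (g : ℝ → ℝ → ℝ) (x : ℝ) : Prop where
  contDiff : ∀ t, ContDiff ℝ 2 (fun s => g s t)
  moment_integrable : ∀ q : ℕ, q ≤ 2 → ∀ s, Integrable (fun t => t ^ q * g s t)
  moment_bounded : ∀ q : ℕ, q ≤ 2 → ∃ M : ℝ, ∀ s, |∫ t, t ^ q * g s t| ≤ M
  moment_continuousAt : ∀ q : ℕ, q ≤ 2 → ContinuousAt (fun s => ∫ t, t ^ q * g s t) x
  abs_moment_integrable : ∀ q ∈ Set.Icc (2 : ℝ) 3, ∀ s, Integrable (fun t => |t| ^ q * g s t)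
  abs_moment_bounded : ∀ q ∈ Set.Icc (2 : ℝ) 3, ∃ M : ℝ, ∀ s, ∫ t, |t| ^ q * g s t ≤ M
  deriv_integrable : ∀ q : ℕ, q ≤ 1 →
    Integrable (fun t => |t| ^ q * |deriv (fun s => g s t) x|)
  deriv2_integrable : ∀ q : ℕ, q ≤ 1 → ∀ s,
    Integrable (fun t => t ^ q * deriv (deriv (fun u => g u t)) s)
  deriv2_bounded : ∀ q : ℕ, q ≤ 1 → ∃ M : ℝ, ∀ s,
    |∫ t, t ^ q * deriv (deriv (fun u => g u t)) s| ≤ M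
  deriv2_continuousAt : ∀ q : ℕ, q ≤ 1 →
    ContinuousAt (fun s => ∫ t, t ^ q * deriv (deriv (fun u => g u t)) s) x

/-- `(X_n, Y_n)`, `n ≥ 1`, are independent pairs, each with joint density `g`. -/
structure IsSample {Ω : Type*} [MeasurableSpace Ω] (P : Measure Ω) (X Y : ℕ → Ω → ℝ)
    (g : ℝ → ℝ → ℝ) : Prop where
  measurable_X : ∀ n, 1 ≤ n → Measurable (X n)
  measurable_Y : ∀ n, 1 ≤ n → Measurable (Y n)
  measurable_density : Measurable (Function.uncurry g)
  density_nonneg : ∀ s t, 0 ≤ g s t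
  indep : iIndepFun (fun (n : ℕ) (ω : Ω) => (X (n + 1) ω, Y (n + 1) ω)) P
  law : ∀ n, 1 ≤ n → P.map (fun ω => (X n ω, Y n ω)) =
    (volume : Measure (ℝ × ℝ)).withDensity (fun p => ENNReal.ofReal (g p.1 p.2))

end SemiRecursive

end

/-!
The estimators `a_n(x)` and `f_n(x)` are recursive averages `v_n = (1 - p_n) v_{n-1} + p_n u_n` of
kernel observations with two different stepsizes, and so are their means; their covariances satisfy
recursions of the same kind. Dividing such a recursion by a scale `m ∈ GS(-μ)` yields a recursion
`w_n = (1 - d_n s_n) w_{n-1} + s_n e_n` with convergent `d_n` and `e_n` and a stepsize `s_n` whose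
sum diverges, so that `w_n → lim e_n / lim d_n`. The limits of `d_n` involve `μ ξ` and produce
the denominators `1 - 2aξ`, `1 - 3a` and `2 - (β - a)ξ` of the theorem. Third moments are negligible
on the scale `m`, so Lyapunov's theorem applies to each linear combination of the pair; the ratio
is linearised as `a_n - r(x) f_n` over `f_n → f(x)`. The two regimes are the scales
`m_n = √(β_n / h_n)`, where the noise survives, and `m_n = h_n²`, where only the bias does.
-/

noncomputable section

namespace SemiRecursive

section Recursion

variable {s z d e ε w : ℕ → ℝ}

/-- The solution of `u n = q n * u (n - 1) + f n`, `n ≥ 1`, started at `u 0 = 0`: the common form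
of the estimators, of their means and of their covariances. -/
def recSeq (q f : ℕ → ℝ) : ℕ → ℝ
  | 0 => 0
  | n + 1 => q (n + 1) * recSeq q f n + f (n + 1)

/-- A stepsize whose sum diverges at least like the harmonic series, the rate being recorded by
`ξ = lim (n * s n)⁻¹`. The value `s 0` plays no role. -/
structure IsStepsize (s : ℕ → ℝ) (ξ : ℝ) : Prop where
  pos : ∀ n, 1 ≤ n → 0 < s n
  tendsto_zero : Tendsto s atTop (𝓝 0)
  tendsto_inv : Tendsto (fun n : ℕ => ((n : ℝ) * s n)⁻¹) atTop (𝓝 ξ)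

theorem not_summable_of_tendsto_inv_natCast_mul {ξ : ℝ} (hs : ∀ᶠ n in atTop, 0 < s n)
    (hξ : Tendsto (fun n : ℕ => ((n : ℝ) * s n)⁻¹) atTop (𝓝 ξ)) : ¬ Summable s := by
  intro hsum
  refine Real.not_summable_one_div_natCast
    ((hsum.mul_left (ξ + 1)).of_norm_bounded_eventually_nat ?_)
  filter_upwards [eventually_ge_atTop 1, hs, hξ.eventually_le_const (lt_add_one ξ)]
    with n hn hsn hle
  have : (0 : ℝ) < n := by exact_mod_cast hn
  calc ‖1 / (n : ℝ)‖ = ((n : ℝ) * s n)⁻¹ * s n := by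
        rw [Real.norm_of_nonneg (by positivity)]
        field_simp
    _ ≤ (ξ + 1) * s n := by gcongr

theorem tendsto_zero_of_le_one_sub_mul (hs : ∀ᶠ n in atTop, 0 ≤ s n) (hsum : ¬ Summable s)
    (hz : ∀ᶠ n in atTop, 0 ≤ z n) (hrec : ∀ᶠ n in atTop, z (n + 1) ≤ (1 - s (n + 1)) * z n) :
    Tendsto z atTop (𝓝 0) := by
  obtain ⟨N, hN⟩ := eventually_atTop.1 ((hs.and hz).and hrec)
  have hbound : ∀ k, z (k + N) ≤
      Real.exp (-∑ j ∈ Finset.range k, s (j + (N + 1))) * z N := by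
    intro k
    induction k with
    | zero => simp
    | succ k ih =>
      rw [Finset.sum_range_succ, neg_add, Real.exp_add, add_right_comm]
      calc z (k + N + 1) ≤ (1 - s (k + N + 1)) * z (k + N) := (hN (k + N) (by lia)).2
        _ ≤ Real.exp (-s (k + N + 1)) * z (k + N) := by
          gcongr
          · exact (hN (k + N) (by lia)).1.2
          · exact Real.one_sub_le_exp_neg _
        _ ≤ Real.exp (-s (k + N + 1)) *
            (Real.exp (-∑ j ∈ Finset.range k, s (j + (N + 1))) * z N) := by gcongr
        _ = _ := by rw [add_assoc]; ring
  have hdiv : Tendsto (fun k => ∑ j ∈ Finset.range k, s (j + (N + 1))) atTop atTop :=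
    (not_summable_iff_tendsto_nat_atTop_of_nonneg fun j => (hN (j + (N + 1)) (by lia)).1.1).1
      (by rwa [summable_nat_add_iff])
  have hlim := (Real.tendsto_exp_neg_atTop_nhds_zero.comp hdiv).mul_const (z N)
  rw [zero_mul] at hlim
  rw [← tendsto_add_atTop_iff_nat N]
  exact squeeze_zero (fun k => (hN (k + N) (by lia)).1.2) hbound hlim

theorem tendsto_zero_of_le_convex_comb (hs : ∀ᶠ n in atTop, 0 ≤ s n) (hs1 : ∀ᶠ n in atTop, s n ≤ 1)
    (hsum : ¬ Summable s) (hz : ∀ᶠ n in atTop, 0 ≤ z n) (hε : Tendsto ε atTop (𝓝 0))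
    (hrec : ∀ᶠ n in atTop, z (n + 1) ≤ (1 - s (n + 1)) * z n + s (n + 1) * ε (n + 1)) :
    Tendsto z atTop (𝓝 0) := by
  refine tendsto_order.2 ⟨fun a ha => hz.mono fun n hn => ha.trans_le hn, fun δ hδ => ?_⟩
  -- above the level `δ / 2` the forcing is harmless, and the excess over this level contracts
  have hexcess : Tendsto (fun n => max (z n - δ / 2) 0) atTop (𝓝 0) := by
    refine tendsto_zero_of_le_one_sub_mul hs hsum (.of_forall fun n => le_max_right _ _) ?_
    have hsucc := tendsto_add_atTop_nat 1
    filter_upwards [hrec, hsucc.eventually hs, hsucc.eventually hs1,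
      hsucc.eventually (hε.eventually_le_const (half_pos hδ))] with n hrec hs0 hs1 hε
    refine max_le ?_ (mul_nonneg (by linarith) (le_max_right _ _))
    calc z (n + 1) - δ / 2 ≤ (1 - s (n + 1)) * z n + s (n + 1) * (δ / 2) - δ / 2 := by
          linarith [mul_le_mul_of_nonneg_left hε hs0]
      _ = (1 - s (n + 1)) * (z n - δ / 2) := by ring
      _ ≤ (1 - s (n + 1)) * max (z n - δ / 2) 0 :=
          mul_le_mul_of_nonneg_left (le_max_left _ _) (by linarith)
  filter_upwards [hexcess.eventually_lt_const (half_pos hδ)] with n hn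
  linarith [le_max_left (z n - δ / 2) 0]

theorem tendsto_of_recursion {d₀ e₀ : ℝ} (hs : ∀ᶠ n in atTop, 0 ≤ s n)
    (hs0 : Tendsto s atTop (𝓝 0)) (hsum : ¬ Summable s) (hd : Tendsto d atTop (𝓝 d₀))
    (hd₀ : 0 < d₀) (he : Tendsto e atTop (𝓝 e₀))
    (hrec : ∀ᶠ n in atTop, w (n + 1) = (1 - s (n + 1) * d (n + 1)) * w n + s (n + 1) * e (n + 1)) :
    Tendsto w atTop (𝓝 (e₀ / d₀)) := by
  have hdpos : ∀ᶠ n in atTop, d₀ / 2 ≤ d n := hd.eventually_const_le (half_lt_self hd₀)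
  have hsd0 : ∀ᶠ n in atTop, 0 ≤ s n * d n := by
    filter_upwards [hs, hdpos] with n hs hd using mul_nonneg hs (by linarith)
  have hsd1 : ∀ᶠ n in atTop, s n * d n ≤ 1 := by
    refine Tendsto.eventually_le_const one_pos ?_
    simpa using hs0.mul hd
  have hsd : ¬ Summable fun n => s n * d n := by
    refine fun h => hsum ((h.mul_left (d₀ / 2)⁻¹).of_norm_bounded_eventually_nat ?_)
    filter_upwards [hs, hdpos] with n hs hd
    rw [Real.norm_of_nonneg hs, ← div_eq_inv_mul, le_div_iff₀ (half_pos hd₀)]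
    gcongr
  have hε : Tendsto (fun n => |e n / d n - e₀ / d₀|) atTop (𝓝 0) := by
    simpa using ((he.div hd hd₀.ne').sub_const (e₀ / d₀)).abs
  rw [tendsto_iff_dist_tendsto_zero]
  refine tendsto_zero_of_le_convex_comb hsd0 hsd1 hsd (.of_forall fun n => dist_nonneg) hε ?_
  have hsucc := tendsto_add_atTop_nat 1
  filter_upwards [hrec, hsucc.eventually hsd0, hsucc.eventually hsd1, hsucc.eventually hdpos]
    with n hrec hsd0 hsd1 hd
  have hdne : d (n + 1) ≠ 0 := by linarith
  have hdecomp : w (n + 1) - e₀ / d₀ = (1 - s (n + 1) * d (n + 1)) * (w n - e₀ / d₀) +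
      s (n + 1) * d (n + 1) * (e (n + 1) / d (n + 1) - e₀ / d₀) := by
    rw [hrec]
    field_simp
    ring
  rw [Real.dist_eq, Real.dist_eq, hdecomp]
  refine (abs_add_le _ _).trans_eq ?_
  rw [abs_mul, abs_mul, abs_of_nonneg hsd0, abs_of_nonneg (sub_nonneg.2 hsd1)]

theorem recSeq_eq_sum (q f : ℕ → ℝ) (n : ℕ) :
    recSeq q f n =
      ∑ k ∈ Finset.range n, (∏ j ∈ Finset.Ioc (k + 1) n, q j) * f (k + 1) := by
  induction n with
  | zero => rfl
  | succ n ih =>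
    rw [recSeq, ih, Finset.sum_range_succ, Finset.Ioc_self, Finset.prod_empty, one_mul,
      Finset.mul_sum]
    congr 1
    refine Finset.sum_congr rfl fun k hk => ?_
    rw [← Finset.insert_Ioc_right_eq_Ioc_add_one (by simp at hk; lia), Finset.prod_insert (by simp)]
    ring

end Recursion

namespace GS

variable {v w m s q f : ℕ → ℝ} {γ δ μ ξ c₀ e₀ : ℝ}

theorem tendsto_ratio (hv : GS v γ) : Tendsto (fun n => v (n - 1) / v n) atTop (𝓝 1) := by
  have hlim := (hv.2.mul tendsto_inv_atTop_nhds_zero_nat).const_sub 1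
  rw [mul_zero, sub_zero] at hlim
  refine hlim.congr' ?_
  filter_upwards [eventually_ge_atTop 1] with n hn
  have : (0 : ℝ) < n := by exact_mod_cast hn
  field_simp
  ring

protected theorem mul (hv : GS v γ) (hw : GS w δ) : GS (fun n => v n * w n) (γ + δ) := by
  refine ⟨fun n hn => mul_pos (hv.1 n hn) (hw.1 n hn), ?_⟩
  have hlim := hv.2.add (hv.tendsto_ratio.mul hw.2)
  rw [one_mul] at hlim
  refine hlim.congr' ?_
  filter_upwards [eventually_ge_atTop 1] with n hn
  have := (hv.1 n hn).ne'
  have := (hw.1 n hn).ne'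
  field_simp
  ring

protected theorem inv (hv : GS v γ) : GS (fun n => (v n)⁻¹) (-γ) := by
  refine ⟨fun n hn => inv_pos.2 (hv.1 n hn), ?_⟩
  have hlim := hv.2.neg.mul (hv.tendsto_ratio.inv₀ one_ne_zero)
  rw [inv_one, mul_one] at hlim
  refine hlim.congr' ?_
  filter_upwards [eventually_ge_atTop 2] with n hn
  have := (hv.1 n (by lia)).ne'
  have := (hv.1 (n - 1) (by lia)).ne'
  field_simp
  ring

protected theorem sqrt (hv : GS v γ) : GS (fun n => √(v n)) (γ / 2) := by
  refine ⟨fun n hn => Real.sqrt_pos.2 (hv.1 n hn), ?_⟩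
  have hratio : Tendsto (fun n => √(v (n - 1) / v n)) atTop (𝓝 1) := by
    simpa using hv.tendsto_ratio.sqrt
  have hlim := hv.2.div (hratio.const_add 1) (by norm_num)
  rw [one_add_one_eq_two] at hlim
  refine hlim.congr' ?_
  filter_upwards [eventually_ge_atTop 2] with n hn
  have hpos := hv.1 n (by lia)
  have hpos' := hv.1 (n - 1) (by lia)
  have hne : 1 + √(v (n - 1) / v n) ≠ 0 := by positivity
  rw [Pi.div_apply, div_eq_iff hne, ← Real.sqrt_div hpos'.le]
  linear_combination (n : ℝ) * Real.sq_sqrt (div_pos hpos' hpos).le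

protected theorem pow (hv : GS v γ) (k : ℕ) : GS (fun n => v n ^ k) (k * γ) := by
  induction k with
  | zero => exact ⟨fun n _ => by simp, by simp⟩
  | succ k ih =>
    simp only [pow_succ, Nat.cast_succ, add_mul, one_mul]
    exact ih.mul hv

theorem natCast : GS (fun n => (n : ℝ)) 1 := by
  refine ⟨fun n hn => Nat.cast_pos.2 hn, tendsto_const_nhds.congr' ?_⟩
  filter_upwards [eventually_ge_atTop 1] with n hn
  have : (n : ℝ) ≠ 0 := by positivity
  rw [Nat.cast_sub hn]
  field_simp
  push_cast
  ring

theorem tendsto_zero (hv : GS v γ) (hγ : γ < 0) : Tendsto v atTop (𝓝 0) := by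
  set s : ℕ → ℝ := fun n => 1 - v n / v (n - 1)
  have hlim : Tendsto (fun n : ℕ => (n : ℝ) * s n) atTop (𝓝 (-γ)) :=
    hv.inv.2.congr fun n => by simp only [inv_div_inv, s]
  have hs : ∀ᶠ n in atTop, 0 < s n := by
    filter_upwards [hlim.eventually_const_lt (neg_pos.2 hγ)] with n hn
    exact pos_of_mul_pos_right hn n.cast_nonneg
  refine tendsto_zero_of_le_one_sub_mul (hs.mono fun n => le_of_lt)
    (not_summable_of_tendsto_inv_natCast_mul hs (hlim.inv₀ (neg_pos.2 hγ).ne')) ?_ ?_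
  · filter_upwards [eventually_ge_atTop 1] with n hn using (hv.1 n hn).le
  · filter_upwards [eventually_ge_atTop 1] with n hn
    rw [sub_sub_cancel, Nat.add_sub_cancel, div_mul_cancel₀ _ (hv.1 n hn).ne']

theorem tendsto_nhdsGT_zero (hv : GS v γ) (hγ : γ < 0) : Tendsto v atTop (𝓝[>] 0) :=
  tendsto_nhdsWithin_iff.2 ⟨hv.tendsto_zero hγ, (eventually_ge_atTop 1).mono hv.1⟩

theorem tendsto_atTop (hv : GS v γ) (hγ : 0 < γ) : Tendsto v atTop atTop :=
  (hv.inv.tendsto_nhdsGT_zero (neg_neg_iff_pos.2 hγ)).inv_tendsto_nhdsGT_zero.congr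
    fun n => inv_inv (v n)

theorem nonpos_of_tendsto {L : ℝ} (hv : GS v γ) (h : Tendsto v atTop (𝓝 L)) : γ ≤ 0 :=
  le_of_not_gt fun hγ => not_tendsto_nhds_of_tendsto_atTop (hv.tendsto_atTop hγ) L h

theorem nonneg_of_tendsto_atTop (hv : GS v γ) (h : Tendsto v atTop atTop) : 0 ≤ γ :=
  le_of_not_gt fun hγ => not_tendsto_nhds_of_tendsto_atTop h 0 (hv.tendsto_zero hγ)

theorem eq_zero_of_tendsto {L : ℝ} (hv : GS v γ) (h : Tendsto v atTop (𝓝 L)) (hL : L ≠ 0) :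
    γ = 0 :=
  (hv.nonpos_of_tendsto h).antisymm <|
    le_of_not_gt fun hγ => hL (tendsto_nhds_unique h (hv.tendsto_zero hγ))

/- Dividing by `m` turns the recursion into one for `w = recSeq q f / m` with the same step `s`;
the factor `m (n - 1) / m n` contributes the drift `-μ (n s n)⁻¹`. -/
theorem tendsto_recSeq_div (hm : GS m (-μ)) (hs : IsStepsize s ξ)
    (hq : Tendsto (fun n => (1 - q n) / s n) atTop (𝓝 c₀)) (hμ : μ * ξ < c₀)
    (hf : Tendsto (fun n => f n / (s n * m n)) atTop (𝓝 e₀)) :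
    Tendsto (fun n => recSeq q f n / m n) atTop (𝓝 (e₀ / (c₀ - μ * ξ))) := by
  set t : ℕ → ℝ := fun n => (n : ℝ) * (1 - m (n - 1) / m n) with ht
  set d : ℕ → ℝ := fun n =>
    (1 - q n) / s n * (m (n - 1) / m n) + t n * ((n : ℝ) * s n)⁻¹ with hd
  have hdlim : Tendsto d atTop (𝓝 (c₀ - μ * ξ)) := by
    have hsum := (hq.mul hm.tendsto_ratio).add (hm.2.mul hs.tendsto_inv)
    rwa [mul_one, neg_mul, ← sub_eq_add_neg] at hsum
  have hspos : ∀ᶠ n in atTop, 0 < s n := (eventually_ge_atTop 1).mono hs.pos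
  refine tendsto_of_recursion (hspos.mono fun n => le_of_lt) hs.tendsto_zero
    (not_summable_of_tendsto_inv_natCast_mul hspos hs.tendsto_inv) hdlim (sub_pos.2 hμ) hf ?_
  filter_upwards [eventually_ge_atTop 1] with n hn
  have := (hm.1 n hn).ne'
  have := (hm.1 (n + 1) n.succ_pos).ne'
  have := (hs.pos (n + 1) n.succ_pos).ne'
  have : ((n + 1 : ℕ) : ℝ) ≠ 0 := by positivity
  simp only [hd, ht, recSeq, Nat.add_sub_cancel]
  field_simp
  ring

end GS

section CharacteristicFunction

theorem norm_exp_mul_I_sub_taylor_le (x : ℝ) :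
    ‖Complex.exp (x * Complex.I) - (1 + x * Complex.I - x ^ 2 / 2)‖ ≤ 5 * |x| ^ 3 := by
  rcases le_or_gt |x| 1 with hx | hx
  · have hbound := Complex.exp_bound (x := x * Complex.I) (n := 3) (by simpa using hx) (by norm_num)
    have hsum : ∑ m ∈ Finset.range 3, ((x : ℂ) * Complex.I) ^ m / (m.factorial : ℂ) =
        1 + x * Complex.I - x ^ 2 / 2 := by
      simp [Finset.sum_range_succ, mul_pow, Nat.factorial]
      ring
    rw [hsum] at hbound
    refine hbound.trans ?_
    simp only [norm_mul, Complex.norm_real, Real.norm_eq_abs, Complex.norm_I, mul_one]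
    norm_num [Nat.factorial]
    linarith [pow_nonneg (abs_nonneg x) 3]
  · have hpoly : ‖(1 : ℂ) + x * Complex.I - x ^ 2 / 2‖ ≤ 1 + |x| + |x| ^ 2 / 2 := by
      refine (norm_sub_le _ _).trans (add_le_add ((norm_add_le _ _).trans ?_) ?_) <;> simp
    refine (norm_sub_le _ _).trans ?_
    rw [Complex.norm_exp_ofReal_mul_I]
    have hpow : |x| ≤ |x| ^ 2 ∧ |x| ^ 2 ≤ |x| ^ 3 := by constructor <;> nlinarith
    linarith

theorem abs_exp_neg_sq_sub_taylor_le {σ : ℝ} (hσ : 0 ≤ σ) :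
    |Real.exp (-σ ^ 2 / 2) - (1 - σ ^ 2 / 2)| ≤ σ ^ 3 := by
  rcases le_or_gt σ 1 with h | h
  · have hbound := Real.abs_exp_sub_one_sub_id_le (x := -σ ^ 2 / 2) (by
      rw [abs_le]; constructor <;> nlinarith)
    have hpow : σ ^ 4 ≤ σ ^ 3 := pow_le_pow_of_le_one hσ h (by norm_num)
    calc |Real.exp (-σ ^ 2 / 2) - (1 - σ ^ 2 / 2)|
        = |Real.exp (-σ ^ 2 / 2) - 1 - -σ ^ 2 / 2| := by congr 1; ring
      _ ≤ (-σ ^ 2 / 2) ^ 2 := hbound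
      _ ≤ σ ^ 3 := by nlinarith [pow_nonneg hσ 4]
  · have hlower := Real.add_one_le_exp (-σ ^ 2 / 2)
    have hupper : Real.exp (-σ ^ 2 / 2) ≤ 1 := Real.exp_le_one_iff.2 (by nlinarith)
    have hpow : σ ^ 2 ≤ σ ^ 3 := pow_le_pow_right₀ h.le (by norm_num)
    rw [abs_le]
    constructor <;> nlinarith

variable {Ω : Type*} [MeasurableSpace Ω] {P : Measure Ω} {Z : Ω → ℝ}

theorem integrable_pow_of_memLp [IsFiniteMeasure P] {k m : ℕ}
    (hZ : MemLp Z m P) (hk : k ≤ m) :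
    Integrable (fun ω => Z ω ^ k) P := by
  have hmem : MemLp Z k P := hZ.mono_exponent (by exact_mod_cast hk)
  exact hmem.integrable_norm_pow'.mono (hmem.1.pow k) (by simp)

variable [IsProbabilityMeasure P]

theorem sqrt_integral_sq_pow_three_le (hZ : MemLp Z 3 P) :
    √(∫ ω, Z ω ^ 2 ∂P) ^ 3 ≤ ∫ ω, |Z ω| ^ 3 ∂P := by
  set σ := √(∫ ω, Z ω ^ 2 ∂P)
  have hσ : 0 ≤ σ := Real.sqrt_nonneg _
  have hσ2 : ∫ ω, Z ω ^ 2 ∂P = σ ^ 2 :=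
    (Real.sq_sqrt (integral_nonneg fun _ => sq_nonneg _)).symm
  -- the tangent line at `σ ^ 2` of the convex function `u ↦ u ^ (3 / 2)`, evaluated at `Z ^ 2`
  have htangent : ∀ ω, 3 / 2 * σ * Z ω ^ 2 - σ ^ 3 / 2 ≤ |Z ω| ^ 3 := by
    intro ω
    rw [← sq_abs]
    nlinarith [mul_nonneg (add_nonneg (mul_nonneg zero_le_two (abs_nonneg (Z ω))) hσ)
      (sq_nonneg (|Z ω| - σ)), abs_nonneg (Z ω)]
  have hint : Integrable (fun ω => 3 / 2 * σ * Z ω ^ 2) P :=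
    (integrable_pow_of_memLp (m := 3) hZ (by norm_num)).const_mul _
  have hint3 : Integrable (fun ω => |Z ω| ^ 3) P := by
    simpa using (integrable_pow_of_memLp (m := 3) hZ le_rfl).norm
  calc σ ^ 3 = ∫ ω, (3 / 2 * σ * Z ω ^ 2 - σ ^ 3 / 2) ∂P := by
        rw [integral_sub hint (integrable_const _), integral_const_mul, hσ2]
        simp
        ring
    _ ≤ ∫ ω, |Z ω| ^ 3 ∂P := integral_mono (hint.sub (integrable_const _)) hint3 htangent

theorem norm_integral_exp_mul_I_sub_le (hZ : MemLp Z 3 P) (h0 : ∫ ω, Z ω ∂P = 0) :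
    ‖∫ ω, Complex.exp (Z ω * Complex.I) ∂P - ((1 - (∫ ω, Z ω ^ 2 ∂P) / 2 : ℝ) : ℂ)‖ ≤
      5 * ∫ ω, |Z ω| ^ 3 ∂P := by
  have hexp : Integrable (fun ω => Complex.exp (Z ω * Complex.I)) P := by
    refine Integrable.of_bound (C := 1) ?_ (ae_of_all _ fun ω => ?_)
    · exact Complex.continuous_exp.comp_aestronglyMeasurable
        ((Complex.continuous_ofReal.comp_aestronglyMeasurable hZ.1).mul_const _)
    · rw [Complex.norm_exp_ofReal_mul_I]
  have hlin : Integrable (fun ω => (Z ω : ℂ) * Complex.I) P :=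
    (hZ.integrable (by norm_num)).ofReal.mul_const _
  have hsq : Integrable (fun ω => (Z ω : ℂ) ^ 2 / 2) P := by
    have := (integrable_pow_of_memLp (k := 2) (m := 3) hZ (by norm_num)).ofReal (𝕜 := ℂ)
    simpa using this.div_const 2
  have hcube : Integrable (fun ω => |Z ω| ^ 3) P := by
    simpa using (integrable_pow_of_memLp (m := 3) hZ le_rfl).norm
  have haff : Integrable (fun ω => (1 : ℂ) + Z ω * Complex.I) P := (integrable_const _).add hlin
  have hquad : Integrable (fun ω => (1 : ℂ) + Z ω * Complex.I - (Z ω : ℂ) ^ 2 / 2) P :=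
    haff.sub hsq
  have htaylor : ∫ ω, ((1 : ℂ) + Z ω * Complex.I - (Z ω : ℂ) ^ 2 / 2) ∂P =
      ((1 - (∫ ω, Z ω ^ 2 ∂P) / 2 : ℝ) : ℂ) := by
    rw [integral_sub haff hsq, integral_add (integrable_const _) hlin, integral_mul_const,
      integral_div, integral_complex_ofReal, h0]
    simp [← integral_complex_ofReal]
  rw [← htaylor, ← integral_sub hexp hquad, ← integral_const_mul]
  exact norm_integral_le_of_norm_le (hcube.const_mul 5)
    (ae_of_all _ fun ω => norm_exp_mul_I_sub_taylor_le (Z ω))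

theorem norm_charFun_map_sub_le (hZ : MemLp Z 3 P) (h0 : ∫ ω, Z ω ∂P = 0) (t : ℝ) :
    ‖charFun (P.map Z) t - Complex.exp (-(t ^ 2 * ∫ ω, Z ω ^ 2 ∂P : ℝ) / 2)‖ ≤
      6 * |t| ^ 3 * ∫ ω, |Z ω| ^ 3 ∂P := by
  set σ := √(∫ ω, (t * Z ω) ^ 2 ∂P)
  have htZ : MemLp (fun ω => t * Z ω) 3 P := hZ.const_mul t
  have hσ2 : ∫ ω, (t * Z ω) ^ 2 ∂P = σ ^ 2 :=
    (Real.sq_sqrt (integral_nonneg fun _ => sq_nonneg _)).symm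
  have hσ2' : t ^ 2 * ∫ ω, Z ω ^ 2 ∂P = σ ^ 2 := by
    rw [← hσ2, ← integral_const_mul]
    simp only [mul_pow]
  have hcube : |t| ^ 3 * ∫ ω, |Z ω| ^ 3 ∂P = ∫ ω, |t * Z ω| ^ 3 ∂P := by
    rw [← integral_const_mul]
    simp only [abs_mul, mul_pow]
  have hchar : charFun (P.map Z) t = ∫ ω, Complex.exp ((t * Z ω : ℝ) * Complex.I) ∂P := by
    rw [charFun_apply_real, integral_map hZ.1.aemeasurable (by fun_prop)]
    simp only [Complex.ofReal_mul]
  have hleft := norm_integral_exp_mul_I_sub_le htZ (by rw [integral_const_mul, h0, mul_zero])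
  have hright : ‖((1 - σ ^ 2 / 2 : ℝ) : ℂ) - Complex.exp (-(σ ^ 2 : ℝ) / 2)‖ ≤
      ∫ ω, |t * Z ω| ^ 3 ∂P := by
    have hexp : Complex.exp (-(σ ^ 2 : ℝ) / 2) = (Real.exp (-σ ^ 2 / 2) : ℂ) := by push_cast; rfl
    rw [hexp, ← Complex.ofReal_sub, Complex.norm_real, Real.norm_eq_abs, abs_sub_comm]
    exact (abs_exp_neg_sq_sub_taylor_le (Real.sqrt_nonneg _)).trans
      (sqrt_integral_sq_pow_three_le htZ)
  rw [hchar, hσ2', mul_assoc, hcube]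
  rw [hσ2] at hleft
  calc _ ≤ _ + _ := norm_sub_le_norm_sub_add_norm_sub _ ((1 - σ ^ 2 / 2 : ℝ) : ℂ) _
    _ ≤ _ := add_le_add hleft hright
    _ = _ := by ring

theorem norm_prod_sub_prod_le {ι 𝕜 : Type*} [NormedField 𝕜] (s : Finset ι) {a b : ι → 𝕜}
    (ha : ∀ i ∈ s, ‖a i‖ ≤ 1) (hb : ∀ i ∈ s, ‖b i‖ ≤ 1) :
    ‖∏ i ∈ s, a i - ∏ i ∈ s, b i‖ ≤ ∑ i ∈ s, ‖a i - b i‖ := by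
  induction s using Finset.cons_induction with
  | empty => simp
  | cons i s hi ih =>
    simp only [Finset.forall_mem_cons] at ha hb
    rw [Finset.prod_cons, Finset.prod_cons, Finset.sum_cons]
    calc ‖a i * ∏ j ∈ s, a j - b i * ∏ j ∈ s, b j‖
        = ‖(a i - b i) * ∏ j ∈ s, a j + b i * (∏ j ∈ s, a j - ∏ j ∈ s, b j)‖ := by
          congr 1; ring
      _ ≤ ‖a i - b i‖ * ‖∏ j ∈ s, a j‖ + ‖b i‖ * ‖∏ j ∈ s, a j - ∏ j ∈ s, b j‖ := by
          simpa only [norm_mul] using norm_add_le ((a i - b i) * ∏ j ∈ s, a j)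
            (b i * (∏ j ∈ s, a j - ∏ j ∈ s, b j))
      _ ≤ ‖a i - b i‖ * 1 + 1 * ∑ j ∈ s, ‖a j - b j‖ := by
          gcongr
          · rw [norm_prod]
            exact Finset.prod_le_one (fun _ _ => norm_nonneg _) ha.2
          · exact hb.1
          · exact ih ha.2 hb.2
      _ = _ := by ring

end CharacteristicFunction

section CentralLimit

variable {Ω : Type*} [MeasurableSpace Ω] {P : Measure Ω} [IsProbabilityMeasure P]

theorem norm_charFun_map_sum_sub_prod_exp_le {ι : Type*} {Z : ι → Ω → ℝ} (s : Finset ι)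
    (hindep : iIndepFun Z P) (hZ : ∀ i, MemLp (Z i) 3 P) (h0 : ∀ i, ∫ ω, Z i ω ∂P = 0) (t : ℝ) :
    ‖charFun (P.map fun ω => ∑ i ∈ s, Z i ω) t -
        ∏ i ∈ s, Complex.exp (-(t ^ 2 * ∫ ω, Z i ω ^ 2 ∂P : ℝ) / 2)‖ ≤
      6 * |t| ^ 3 * ∑ i ∈ s, ∫ ω, |Z i ω| ^ 3 ∂P := by
  have hprod : charFun (P.map fun ω => ∑ i ∈ s, Z i ω) t = ∏ i ∈ s, charFun (P.map (Z i)) t := by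
    rw [(hindep.restrict _).charFun_map_fun_finsetSum_eq_prod fun i _ => (hZ i).1.aemeasurable,
      Finset.prod_apply]
  rw [hprod, Finset.mul_sum]
  refine (norm_prod_sub_prod_le _ (fun i _ => ?_) fun i _ => ?_).trans
    (Finset.sum_le_sum fun i _ => norm_charFun_map_sub_le (hZ i) (h0 i) t)
  · have := Measure.isProbabilityMeasure_map (hZ i).1.aemeasurable
    exact norm_charFun_le_one t
  · have hnonneg : 0 ≤ t ^ 2 * ∫ ω, Z i ω ^ 2 ∂P :=
      mul_nonneg (sq_nonneg t) (integral_nonneg fun ω => sq_nonneg _)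
    rw [Complex.norm_exp, Real.exp_le_one_iff, Complex.div_ofNat_re, Complex.neg_re,
      Complex.ofReal_re]
    linarith

theorem tendstoInDistribution_sum_of_lyapunov {ι : Type*} {S : ℕ → Finset ι}
    {Z : ℕ → ι → Ω → ℝ} {v : ℝ} (hindep : ∀ n, iIndepFun (Z n) P)
    (hZ : ∀ n i, MemLp (Z n i) 3 P) (h0 : ∀ n i, ∫ ω, Z n i ω ∂P = 0)
    (hvar : Tendsto (fun n => ∑ i ∈ S n, ∫ ω, Z n i ω ^ 2 ∂P) atTop (𝓝 v))
    (hthird : Tendsto (fun n => ∑ i ∈ S n, ∫ ω, |Z n i ω| ^ 3 ∂P) atTop (𝓝 0)) :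
    TendstoInDistribution (fun n ω => ∑ i ∈ S n, Z n i ω) atTop id (fun _ => P)
      (gaussianReal 0 v.toNNReal) where
  forall_aemeasurable n := Finset.aemeasurable_fun_sum _ fun i _ => (hZ n i).1.aemeasurable
  tendsto := by
    refine ProbabilityMeasure.tendsto_iff_tendsto_charFun.2 fun t => ?_
    have hv : 0 ≤ v := ge_of_tendsto' hvar fun n =>
      Finset.sum_nonneg fun i _ => integral_nonneg fun ω => sq_nonneg _
    have hgauss : Tendsto (fun n => ∏ i ∈ S n,
        Complex.exp (-(t ^ 2 * ∫ ω, Z n i ω ^ 2 ∂P : ℝ) / 2)) atTop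
        (𝓝 (charFun (gaussianReal 0 v.toNNReal) t)) := by
      have hexp := (Complex.continuous_exp.comp Complex.continuous_ofReal).continuousAt.tendsto.comp
        ((hvar.const_mul (t ^ 2)).neg.div_const 2)
      convert! hexp using 1
      · ext n
        simp [← Complex.exp_sum, Finset.mul_sum, Finset.sum_div, neg_div]
      · rw [charFun_gaussianReal]
        simp only [Function.comp_apply, Real.coe_toNNReal v hv]
        congr 2
        push_cast
        ring
    have hdist : Tendsto (fun n => charFun (P.map fun ω => ∑ i ∈ S n, Z n i ω) t -
        ∏ i ∈ S n, Complex.exp (-(t ^ 2 * ∫ ω, Z n i ω ^ 2 ∂P : ℝ) / 2)) atTop (𝓝 0) :=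
      squeeze_zero_norm (fun n => norm_charFun_map_sum_sub_prod_exp_le _ (hindep n) (hZ n) (h0 n) t)
        (by simpa using hthird.const_mul (6 * |t| ^ 3))
    simpa [Measure.map_id] using hdist.add hgauss

end CentralLimit

section Convergence

variable {ι Ω Ω' E E' : Type*} {l : Filter ι} [MeasurableSpace Ω] {P : Measure Ω}
  [MeasurableSpace Ω'] {P' : Measure Ω'} [IsProbabilityMeasure P']

theorem tendstoInMeasure_const_of_tendsto [PseudoEMetricSpace E] {u : ι → E} {c : E}
    (hu : Tendsto u l (𝓝 c)) : TendstoInMeasure P (fun i _ => u i) l (fun _ => c) := by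
  intro ε hε
  refine tendsto_const_nhds.congr' ?_
  filter_upwards [EMetric.tendsto_nhds.1 hu ε hε] with i hi
  simp [hi.not_ge]

theorem tendstoInMeasure_comp_continuousAt [PseudoMetricSpace E] [PseudoMetricSpace E']
    {Z : ι → Ω → E} {c : E} {φ : E → E'} (hZ : TendstoInMeasure P Z l (fun _ => c))
    (hφ : ContinuousAt φ c) :
    TendstoInMeasure P (fun i ω => φ (Z i ω)) l (fun _ => φ c) := by
  rw [tendstoInMeasure_iff_dist] at hZ ⊢
  intro ε hε
  obtain ⟨δ, hδ, hδε⟩ := Metric.continuousAt_iff.1 hφ ε hε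
  refine tendsto_of_tendsto_of_tendsto_of_le_of_le tendsto_const_nhds (hZ δ hδ)
    (fun _ => zero_le) fun i => measure_mono fun ω hω => ?_
  simp only [Set.mem_ofPred_eq] at hω ⊢
  exact le_of_not_gt fun hlt => hω.not_gt (hδε hlt)

variable [IsProbabilityMeasure P]

theorem tendstoInDistribution_id_of_hasLaw [TopologicalSpace E] [MeasurableSpace E]
    [OpensMeasurableSpace E] {Z : ι → Ω → E} {W : Ω' → E} {ν : Measure E}
    [IsProbabilityMeasure ν] (h : TendstoInDistribution Z l W (fun _ => P) P')
    (hW : HasLaw W ν P') : TendstoInDistribution Z l id (fun _ => P) ν where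
  forall_aemeasurable := h.forall_aemeasurable
  tendsto := by simpa only [Measure.map_id, ← hW.map_eq] using h.tendsto

theorem tendstoInMeasure_of_tendstoInDistribution_dirac [PseudoMetricSpace E]
    [MeasurableSpace E] [BorelSpace E] {Z : ι → Ω → E} {c : E}
    (h : TendstoInDistribution Z l id (fun _ => P) (.dirac c)) :
    TendstoInMeasure P Z l (fun _ => c) := by
  refine tendstoInMeasure_iff_dist.2 fun ε hε => ?_
  have hclosed : IsClosed {z : E | ε ≤ dist z c} := isClosed_le (by fun_prop) (by fun_prop)
  have hnull : Measure.dirac c {z : E | ε ≤ dist z c} = 0 := by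
    rw [Measure.dirac_apply' _ hclosed.measurableSet]
    simp [hε]
  have hlim := ProbabilityMeasure.tendsto_measure_of_null_frontier_of_tendsto' h.tendsto
    (E := {z | ε ≤ dist z c}) <| by
      rw [ProbabilityMeasure.coe_mk, Measure.map_id]
      exact measure_mono_null hclosed.frontier_subset hnull
  simp only [ProbabilityMeasure.coe_mk, Measure.map_id, hnull] at hlim
  exact hlim.congr fun i =>
    Measure.map_apply_of_aemeasurable (h.forall_aemeasurable i) hclosed.measurableSet

theorem tendstoInMeasure_zero_of_tendstoInDistribution_inv_mul [l.IsCountablyGenerated]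
    {Z : ι → Ω → ℝ} {m : ι → ℝ} {W : Ω' → ℝ} (hm : Tendsto m l (𝓝[≠] 0))
    (h : TendstoInDistribution (fun i ω => (m i)⁻¹ * Z i ω) l W (fun _ => P) P') :
    TendstoInMeasure P Z l (fun _ => 0) := by
  have hmul := h.continuous_comp_prodMk_of_tendstoInMeasure_const
    (g := fun z : ℝ × ℝ => z.2 * z.1) (by fun_prop)
    (tendstoInMeasure_const_of_tendsto (hm.mono_right nhdsWithin_le_nhds))
    fun _ => aemeasurable_const
  simp only [zero_mul] at hmul
  refine (tendstoInMeasure_of_tendstoInDistribution_dirac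
    (tendstoInDistribution_id_of_hasLaw hmul (hasLaw_dirac_iff.2 .rfl))).congr' ?_ .rfl
  filter_upwards [hm.eventually self_mem_nhdsWithin] with i hi
  exact .of_forall fun ω => mul_inv_cancel_left₀ hi _

theorem tendstoInDistribution_mul_div_sub [l.IsCountablyGenerated] {A F : ι → Ω → ℝ} {w : ι → ℝ}
    {W : Ω' → ℝ} {r f : ℝ} (hA : ∀ i, AEMeasurable (A i) P) (hF : ∀ i, AEMeasurable (F i) P)
    (hf : f ≠ 0)
    (h : TendstoInDistribution (fun i ω => w i * (A i ω - r * F i ω)) l W (fun _ => P) P')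
    (hFf : TendstoInMeasure P F l (fun _ => f)) :
    TendstoInDistribution (fun i ω => w i * (A i ω / F i ω - r)) l (fun ω => W ω / f)
      (fun _ => P) P' := by
  have hmul := h.continuous_comp_prodMk_of_tendstoInMeasure_const
    (g := fun z : ℝ × ℝ => z.1 * z.2) (by fun_prop)
    (tendstoInMeasure_comp_continuousAt hFf (continuousAt_inv₀ hf)) fun i => (hF i).inv
  refine tendstoInDistribution_of_tendstoInMeasure_sub _ _ hmul ?_
    fun i => (((hA i).div (hF i)).sub_const r).const_mul _
  rw [tendstoInMeasure_iff_norm] at hFf ⊢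
  intro ε hε
  -- the two expressions differ only where `F i` vanishes, that is, far from `f`
  refine tendsto_of_tendsto_of_tendsto_of_le_of_le tendsto_const_nhds (hFf |f| (abs_pos.2 hf))
    (fun _ => zero_le) fun i => measure_mono fun ω hω => ?_
  simp only [Set.mem_ofPred_eq, Pi.sub_apply, Pi.zero_apply, sub_zero] at hω ⊢
  have hzero : F i ω = 0 := by
    by_contra hne
    have hdiff : w i * (A i ω / F i ω - r) - w i * (A i ω - r * F i ω) * (F i ω)⁻¹ = 0 := by
      field_simp
      ring
    rw [hdiff, norm_zero] at hω
    exact hω.not_gt hε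
  simp [hzero]

end Convergence

section RecursiveAverage

/-- The recursive average `v n = (1 - p n) * v (n - 1) + p n * u n`, `v 0 = 0`, of the observations
`u 1, u 2, …` with stepsizes `p 1, p 2, …`. -/
def recAvg (p u : ℕ → ℝ) : ℕ → ℝ := recSeq (fun n => 1 - p n) (fun n => p n * u n)

/-- The weight of the observation `u (k + 1)` in `recAvg p u n`, for `k < n`. -/
def recWeight (p : ℕ → ℝ) (n k : ℕ) : ℝ := (∏ j ∈ Finset.Ioc (k + 1) n, (1 - p j)) * p (k + 1)

theorem recAvg_eq_sum (p u : ℕ → ℝ) (n : ℕ) :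
    recAvg p u n = ∑ k ∈ Finset.range n, recWeight p n k * u (k + 1) := by
  simp only [recAvg, recSeq_eq_sum, recWeight, mul_assoc]

theorem recAvg_sub (p u v : ℕ → ℝ) (n : ℕ) :
    recAvg p (fun k => u k - v k) n = recAvg p u n - recAvg p v n := by
  simp only [recAvg_eq_sum, mul_sub, Finset.sum_sub_distrib]

theorem sum_recWeight_mul_recWeight_mul (p q e : ℕ → ℝ) (n : ℕ) :
    ∑ k ∈ Finset.range n, recWeight p n k * recWeight q n k * e (k + 1) =
      recSeq (fun n => (1 - p n) * (1 - q n)) (fun n => p n * q n * e n) n := by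
  rw [recSeq_eq_sum]
  refine Finset.sum_congr rfl fun k _ => ?_
  rw [recWeight, recWeight, Finset.prod_mul_distrib]
  ring

theorem sum_abs_recWeight_pow_mul (p e : ℕ → ℝ) (r n : ℕ) :
    ∑ k ∈ Finset.range n, |recWeight p n k| ^ r * e (k + 1) =
      recSeq (fun n => |1 - p n| ^ r) (fun n => |p n| ^ r * e n) n := by
  rw [recSeq_eq_sum]
  refine Finset.sum_congr rfl fun k _ => ?_
  rw [recWeight, abs_mul, mul_pow, Finset.abs_prod, Finset.prod_pow, mul_assoc]

variable {Ω ι : Type*} [MeasurableSpace Ω] {P : Measure Ω} [Fintype ι]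

theorem integral_sq_sum {U : ι → Ω → ℝ} (hU : ∀ i, MemLp (U i) 2 P) (c : ι → ℝ) :
    ∫ ω, (∑ i, c i * U i ω) ^ 2 ∂P = ∑ i, ∑ j, c i * c j * ∫ ω, U i ω * U j ω ∂P := by
  have hint : ∀ i j, Integrable (fun ω => c i * c j * (U i ω * U j ω)) P := fun i j =>
    ((hU i).integrable_mul (hU j)).const_mul _
  have hexpand : ∀ ω, (∑ i, c i * U i ω) ^ 2 = ∑ i, ∑ j, c i * c j * (U i ω * U j ω) := fun ω => by
    rw [sq, Finset.sum_mul_sum]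
    exact Finset.sum_congr rfl fun i _ => Finset.sum_congr rfl fun j _ => by ring
  simp_rw [hexpand]
  rw [integral_finsetSum _ fun i _ => integrable_finsetSum _ fun j _ => hint i j]
  refine Finset.sum_congr rfl fun i _ => ?_
  rw [integral_finsetSum _ fun j _ => hint i j]
  simp only [integral_const_mul]

theorem integral_abs_sum_pow_succ_le [IsFiniteMeasure P] {U : ι → Ω → ℝ} {r : ℕ}
    (hU : ∀ i, MemLp (U i) (r + 1 : ℕ) P) (c : ι → ℝ) :
    ∫ ω, |∑ i, c i * U i ω| ^ (r + 1) ∂P ≤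
      Fintype.card ι ^ r * ∑ i, |c i| ^ (r + 1) * ∫ ω, |U i ω| ^ (r + 1) ∂P := by
  have hint : ∀ i, Integrable (fun ω => |c i| ^ (r + 1) * |U i ω| ^ (r + 1)) P := fun i =>
    (integrable_pow_of_memLp (hU i).abs le_rfl).const_mul _
  have hmem : MemLp (fun ω => ∑ i, c i * U i ω) (r + 1 : ℕ) P :=
    memLp_finsetSum _ fun i _ => (hU i).const_mul (c i)
  calc ∫ ω, |∑ i, c i * U i ω| ^ (r + 1) ∂P
      ≤ ∫ ω, Fintype.card ι ^ r * ∑ i, |c i| ^ (r + 1) * |U i ω| ^ (r + 1) ∂P := by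
        refine integral_mono (integrable_pow_of_memLp hmem.abs le_rfl)
          ((integrable_finsetSum _ fun i _ => hint i).const_mul _) fun ω => ?_
        calc |∑ i, c i * U i ω| ^ (r + 1) ≤ (∑ i, |c i * U i ω|) ^ (r + 1) := by
              gcongr
              exact Finset.abs_sum_le_sum_abs _ _
          _ ≤ Fintype.card ι ^ r * ∑ i, |c i * U i ω| ^ (r + 1) :=
              pow_sum_le_card_mul_sum_pow (fun _ _ => abs_nonneg _) r
          _ = _ := by simp only [abs_mul, mul_pow]
    _ = _ := by
        rw [integral_const_mul, integral_finsetSum _ fun i _ => hint i]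
        simp only [integral_const_mul]

variable {p : ι → ℕ → ℝ} {U : ι → ℕ → Ω → ℝ} {m : ℕ → ℝ} {S : ι → ι → ℝ}

theorem tendsto_sum_integral_sq_recWeight (hU : ∀ i n, MemLp (U i (n + 1)) 2 P)
    (hcov : ∀ i j, Tendsto (fun n => recSeq (fun n => (1 - p i n) * (1 - p j n))
      (fun n => p i n * p j n * ∫ ω, U i n ω * U j n ω ∂P) n / m n ^ 2) atTop (𝓝 (S i j)))
    (c : ι → ℝ) :
    Tendsto (fun n => ∑ k ∈ Finset.range n,
      ∫ ω, (∑ i, (m n)⁻¹ * c i * recWeight (p i) n k * U i (k + 1) ω) ^ 2 ∂P) atTop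
      (𝓝 (∑ i, ∑ j, c i * c j * S i j)) := by
  refine (tendsto_finsetSum Finset.univ fun i _ => tendsto_finsetSum Finset.univ fun j _ =>
    (hcov i j).const_mul (c i * c j)).congr fun n => Eq.symm ?_
  simp_rw [integral_sq_sum fun i => hU i _,
    ← sum_recWeight_mul_recWeight_mul _ _ fun n => ∫ ω, U _ n ω * U _ n ω ∂P]
  rw [Finset.sum_comm]
  refine Finset.sum_congr rfl fun i _ => ?_
  rw [Finset.sum_comm]
  refine Finset.sum_congr rfl fun j _ => ?_
  rw [Finset.sum_div, Finset.mul_sum]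
  exact Finset.sum_congr rfl fun k _ => by ring

theorem tendsto_sum_integral_abs_pow_recWeight [IsFiniteMeasure P] {r : ℕ}
    (hU : ∀ i n, MemLp (U i (n + 1)) (r + 1 : ℕ) P)
    (hpow : ∀ i, Tendsto (fun n => recSeq (fun n => |1 - p i n| ^ (r + 1))
      (fun n => |p i n| ^ (r + 1) * ∫ ω, |U i n ω| ^ (r + 1) ∂P) n / |m n| ^ (r + 1)) atTop (𝓝 0))
    (c : ι → ℝ) :
    Tendsto (fun n => ∑ k ∈ Finset.range n,
      ∫ ω, |∑ i, (m n)⁻¹ * c i * recWeight (p i) n k * U i (k + 1) ω| ^ (r + 1) ∂P) atTop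
      (𝓝 0) := by
  have hbound := (tendsto_finsetSum Finset.univ fun i _ =>
    (hpow i).const_mul (|c i| ^ (r + 1))).const_mul ((Fintype.card ι : ℝ) ^ r)
  simp only [mul_zero, Finset.sum_const_zero] at hbound
  refine squeeze_zero (fun n => by positivity) (fun n => ?_) hbound
  refine (Finset.sum_le_sum fun k _ => integral_abs_sum_pow_succ_le (fun i => hU i k) _).trans_eq ?_
  simp_rw [← sum_abs_recWeight_pow_mul _ fun n => ∫ ω, |U _ n ω| ^ (r + 1) ∂P]
  rw [← Finset.mul_sum, Finset.sum_comm]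
  congr 1
  refine Finset.sum_congr rfl fun i _ => ?_
  rw [Finset.sum_div, Finset.mul_sum]
  refine Finset.sum_congr rfl fun k _ => ?_
  rw [abs_mul, abs_mul, abs_inv]
  ring

theorem tendstoInDistribution_sum_recAvg [IsProbabilityMeasure P]
    (hindep : iIndepFun (fun (n : ℕ) (ω : Ω) (i : ι) => U i (n + 1) ω) P)
    (hU : ∀ i n, MemLp (U i (n + 1)) 3 P) (h0 : ∀ i n, ∫ ω, U i (n + 1) ω ∂P = 0)
    (hcov : ∀ i j, Tendsto (fun n => recSeq (fun n => (1 - p i n) * (1 - p j n))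
      (fun n => p i n * p j n * ∫ ω, U i n ω * U j n ω ∂P) n / m n ^ 2) atTop (𝓝 (S i j)))
    (hthird : ∀ i, Tendsto (fun n => recSeq (fun n => |1 - p i n| ^ 3)
      (fun n => |p i n| ^ 3 * ∫ ω, |U i n ω| ^ 3 ∂P) n / |m n| ^ 3) atTop (𝓝 0))
    (c : ι → ℝ) :
    TendstoInDistribution (fun n ω => (m n)⁻¹ * ∑ i, c i * recAvg (p i) (fun k => U i k ω) n)
      atTop id (fun _ => P) (gaussianReal 0 (∑ i, ∑ j, c i * c j * S i j).toNNReal) := by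
  have hclt := tendstoInDistribution_sum_of_lyapunov (P := P) (S := Finset.range)
    (Z := fun n k ω => ∑ i, (m n)⁻¹ * c i * recWeight (p i) n k * U i (k + 1) ω)
    (fun n => hindep.comp
      (fun k u => ∑ i, (m n)⁻¹ * c i * recWeight (p i) n k * u i) fun k => by fun_prop)
    (fun n k => memLp_finsetSum _ fun i _ => (hU i k).const_mul _)
    (fun n k => by
      rw [integral_finsetSum _ fun i _ => ((hU i k).integrable (by norm_num)).const_mul _]
      simp [integral_const_mul, h0])
    (tendsto_sum_integral_sq_recWeight (fun i n => (hU i n).mono_exponent (by norm_num)) hcov c)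
    (tendsto_sum_integral_abs_pow_recWeight (r := 2) (by exact_mod_cast hU) hthird c)
  convert hclt using 3 with n ω
  simp_rw [recAvg_eq_sum, Finset.mul_sum]
  rw [Finset.sum_comm]
  exact Finset.sum_congr rfl fun k _ => Finset.sum_congr rfl fun i _ => by ring

theorem integral_abs_sub_integral_pow_le [IsProbabilityMeasure P] {Z : Ω → ℝ} {r : ℕ}
    (hZ : MemLp Z r P) :
    ∫ ω, |Z ω - ∫ ω, Z ω ∂P| ^ r ∂P ≤ 2 ^ r * ∫ ω, |Z ω| ^ r ∂P := by
  obtain _ | r := r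
  · simp
  have hpow : Integrable (fun ω => |Z ω| ^ (r + 1)) P := integrable_pow_of_memLp hZ.abs le_rfl
  have hint : Integrable Z P := hZ.integrable (by exact_mod_cast Nat.le_add_left 1 r)
  have hjensen : |∫ ω, Z ω ∂P| ^ (r + 1) ≤ ∫ ω, |Z ω| ^ (r + 1) ∂P :=
    (pow_le_pow_left₀ (abs_nonneg _) abs_integral_le_integral_abs _).trans <|
      (convexOn_pow (r + 1)).map_integral_le (by fun_prop) isClosed_Ici
        (ae_of_all _ fun ω => Set.mem_Ici.2 (abs_nonneg _)) hint.abs hpow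
  calc ∫ ω, |Z ω - ∫ ω, Z ω ∂P| ^ (r + 1) ∂P
      ≤ ∫ ω, 2 ^ r * (|Z ω| ^ (r + 1) + |∫ ω, Z ω ∂P| ^ (r + 1)) ∂P := by
        refine integral_mono (integrable_pow_of_memLp (hZ.sub (memLp_const _)).abs le_rfl)
          ((hpow.add (integrable_const _)).const_mul _) fun ω => ?_
        exact (pow_le_pow_left₀ (abs_nonneg _) (abs_sub _ _) _).trans
          (add_pow_le (abs_nonneg _) (abs_nonneg _) _)
    _ = 2 ^ r * (∫ ω, |Z ω| ^ (r + 1) ∂P + |∫ ω, Z ω ∂P| ^ (r + 1)) := by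
        rw [integral_const_mul, integral_add hpow (integrable_const _), integral_const,
          probReal_univ, one_smul]
    _ ≤ 2 ^ (r + 1) * ∫ ω, |Z ω| ^ (r + 1) ∂P := by
        rw [pow_succ 2, mul_assoc, two_mul]
        gcongr

theorem tendstoInDistribution_sum_recAvg_sub_integral [IsProbabilityMeasure P]
    (hindep : iIndepFun (fun (n : ℕ) (ω : Ω) (i : ι) => U i (n + 1) ω) P)
    (hU : ∀ i n, MemLp (U i (n + 1)) 3 P)
    (hcov : ∀ i j, Tendsto (fun n => recSeq (fun n => (1 - p i n) * (1 - p j n))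
      (fun n => p i n * p j n * cov[U i n, U j n; P]) n / m n ^ 2) atTop (𝓝 (S i j)))
    (hthird : ∀ i, Tendsto (fun n => recSeq (fun n => |1 - p i n| ^ 3)
      (fun n => |p i n| ^ 3 * ∫ ω, |U i n ω| ^ 3 ∂P) n / |m n| ^ 3) atTop (𝓝 0))
    (c : ι → ℝ) :
    TendstoInDistribution (fun n ω => (m n)⁻¹ * ∑ i, c i *
        (recAvg (p i) (fun k => U i k ω) n - recAvg (p i) (fun k => ∫ ω, U i k ω ∂P) n))
      atTop id (fun _ => P) (gaussianReal 0 (∑ i, ∑ j, c i * c j * S i j).toNNReal) := by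
  simp_rw [← recAvg_sub]
  refine tendstoInDistribution_sum_recAvg (U := fun i n ω => U i n ω - ∫ ω, U i n ω ∂P)
    (hindep.comp (fun n u i => u i - ∫ ω, U i (n + 1) ω ∂P) fun n => by fun_prop)
    (fun i n => (hU i n).sub (memLp_const _)) (fun i n => ?_) hcov (fun i => ?_) c
  · rw [integral_sub ((hU i n).integrable (by norm_num)) (integrable_const _), integral_const,
      probReal_univ, one_smul, sub_self]
  · have hbound := (hthird i).const_mul (2 ^ 3)
    rw [mul_zero] at hbound
    refine squeeze_zero (fun n => ?_) (fun n => ?_) hbound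
    · rw [← sum_abs_recWeight_pow_mul _ fun n => ∫ ω, |U i n ω - ∫ ω, U i n ω ∂P| ^ 3 ∂P]
      positivity
    · rw [← mul_div_assoc, ← sum_abs_recWeight_pow_mul _ fun n => ∫ ω, |U i n ω| ^ 3 ∂P,
        ← sum_abs_recWeight_pow_mul _ fun n => ∫ ω, |U i n ω - ∫ ω, U i n ω ∂P| ^ 3 ∂P,
        Finset.mul_sum]
      gcongr ?_ / _
      refine Finset.sum_le_sum fun k _ => ?_
      rw [mul_left_comm]
      gcongr
      exact integral_abs_sub_integral_pow_le (by exact_mod_cast hU i k)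

theorem sum_sum_nonneg_of_tendsto_recSeq_covariance [IsFiniteMeasure P]
    (hU : ∀ i n, MemLp (U i (n + 1)) 2 P)
    (hcov : ∀ i j, Tendsto (fun n => recSeq (fun n => (1 - p i n) * (1 - p j n))
      (fun n => p i n * p j n * cov[U i n, U j n; P]) n / m n ^ 2) atTop (𝓝 (S i j)))
    (c : ι → ℝ) : 0 ≤ ∑ i, ∑ j, c i * c j * S i j :=
  ge_of_tendsto' (tendsto_sum_integral_sq_recWeight (U := fun i n ω => U i n ω - ∫ ω, U i n ω ∂P)
    (fun i n => (hU i n).sub (memLp_const _)) hcov c)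
    fun _ => Finset.sum_nonneg fun _ _ => integral_nonneg fun _ => sq_nonneg _

end RecursiveAverage

section Smoothing

/-- The second order Taylor quotient of `G` at `x`; its value at `y = 0` is `0`. -/
def taylorQuotient (G : ℝ → ℝ) (x y : ℝ) : ℝ := (G (x + y) - G x - deriv G x * y) / y ^ 2

/-- The function `G` smoothed at the point `x` by the kernel `k` with bandwidth `h`. -/
def smooth (k G : ℝ → ℝ) (x h : ℝ) : ℝ := ∫ z, k z * G (x - h * z)

/-- The properties of a kernel on which the limit theorem rests: it is a second order kernel, and
its third absolute moment as a function is finite. -/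
structure IsSecondOrderKernel (K : ℝ → ℝ) : Prop where
  measurable : Measurable K
  integrable : Integrable K
  integral_eq_one : ∫ z, K z = 1
  integrable_one : Integrable (fun z => z * K z)
  integral_one : ∫ z, z * K z = 0
  integrable_two : Integrable (fun z => z ^ 2 * K z)
  memLp_three : MemLp K 3

theorem TwiceDifferentiableAt.continuousAt {G : ℝ → ℝ} {x : ℝ}
    (hG : TwiceDifferentiableAt G x) : ContinuousAt G x := hG.1.self_of_nhds.continuousAt

theorem TwiceDifferentiableAt.tendsto_taylorQuotient {G : ℝ → ℝ} {x : ℝ}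
    (hG : TwiceDifferentiableAt G x) :
    Tendsto (taylorQuotient G x) (𝓝[≠] 0) (𝓝 (deriv (deriv G) x / 2)) := by
  have hshift : Tendsto (fun y : ℝ => x + y) (𝓝 0) (𝓝 x) :=
    Continuous.tendsto' (by fun_prop) _ _ (add_zero x)
  have hderiv : ∀ᶠ y in 𝓝 (0 : ℝ), HasDerivAt (fun y => G (x + y) - G x - deriv G x * y)
      (deriv G (x + y) - deriv G x) y := by
    filter_upwards [hshift.eventually hG.1] with y hy
    exact ((hy.hasDerivAt.comp_const_add x y).sub_const (G x)).sub
      (by simpa using (hasDerivAt_id y).const_mul (deriv G x))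
  refine HasDerivAt.lhopital_zero_nhdsNE (f' := fun y => deriv G (x + y) - deriv G x)
    (g' := fun y => 2 * y) (hderiv.filter_mono nhdsWithin_le_nhds)
    (.of_forall fun y => by simpa using hasDerivAt_pow 2 y) ?_ ?_ ?_ ?_
  · filter_upwards [self_mem_nhdsWithin] with y hy using mul_ne_zero two_ne_zero hy
  · have hcont := hderiv.self_of_nhds.continuousAt.tendsto
    simp only [add_zero, sub_self, mul_zero] at hcont
    exact hcont.mono_left nhdsWithin_le_nhds
  · exact (Continuous.tendsto' (by fun_prop) _ _ (by simp)).mono_left nhdsWithin_le_nhds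
  · refine ((hasDerivAt_iff_tendsto_slope_zero.1 hG.2.hasDerivAt).div_const 2).congr' ?_
    filter_upwards [self_mem_nhdsWithin] with y hy
    have hy : y ≠ 0 := hy
    rw [smul_eq_mul]
    field_simp

theorem TwiceDifferentiableAt.exists_abs_taylorQuotient_le {G : ℝ → ℝ} {x M : ℝ}
    (hG : TwiceDifferentiableAt G x) (hM : ∀ s, |G s| ≤ M) :
    ∃ C, ∀ y, |taylorQuotient G x y| ≤ C := by
  obtain ⟨δ, hδ, hnear⟩ := Metric.eventually_nhds_iff.1 <| eventually_nhdsWithin_iff.1 <|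
    hG.tendsto_taylorQuotient.abs.eventually_le_const (lt_add_one |deriv (deriv G) x / 2|)
  have hM0 : 0 ≤ M := (abs_nonneg _).trans (hM x)
  refine ⟨max (|deriv (deriv G) x / 2| + 1) (2 * M / δ ^ 2 + |deriv G x| / δ), fun y => ?_⟩
  rcases eq_or_ne y 0 with rfl | hy
  · simp only [taylorQuotient, ne_eq, OfNat.ofNat_ne_zero, not_false_eq_true, zero_pow, div_zero,
      abs_zero]
    exact le_max_of_le_left (by positivity)
  rcases lt_or_ge |y| δ with hlt | hge
  · exact le_max_of_le_left (hnear (by simpa using hlt) hy)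
  · have : 0 < |y| := abs_pos.2 hy
    have hnum : |G (x + y) - G x - deriv G x * y| ≤ 2 * M + |deriv G x| * |y| := by
      rw [← abs_mul]
      refine (abs_sub _ _).trans (add_le_add_left ((abs_sub _ _).trans ?_) _)
      linarith [hM (x + y), hM x]
    refine le_max_of_le_right ?_
    rw [taylorQuotient, abs_div, abs_pow]
    calc _ ≤ (2 * M + |deriv G x| * |y|) / |y| ^ 2 := by gcongr
      _ = 2 * M / |y| ^ 2 + |deriv G x| / |y| := by field_simp
      _ ≤ 2 * M / δ ^ 2 + |deriv G x| / δ := by gcongr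

variable {k K G : ℝ → ℝ} {M x : ℝ}

theorem integrable_mul_comp_sub_mul (hk : Integrable k) (hG : Measurable G)
    (hM : ∀ s, |G s| ≤ M) (x h : ℝ) : Integrable fun z => k z * G (x - h * z) :=
  hk.mul_bdd (c := M) (hG.comp (by fun_prop)).aestronglyMeasurable (ae_of_all _ fun _ => hM _)

theorem abs_smooth_le (hk : Integrable k) (hM : ∀ s, |G s| ≤ M) (x h : ℝ) :
    |smooth k G x h| ≤ M * ∫ z, |k z| := by
  rw [smooth, ← Real.norm_eq_abs, ← integral_const_mul]
  refine norm_integral_le_of_norm_le (hk.abs.const_mul M) (ae_of_all _ fun z => ?_)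
  rw [norm_mul, mul_comm, Real.norm_eq_abs, Real.norm_eq_abs]
  gcongr
  exact hM _

theorem tendsto_smooth (hk : Integrable k) (hG : Measurable G) (hM : ∀ s, |G s| ≤ M)
    (hx : ContinuousAt G x) :
    Tendsto (smooth k G x) (𝓝 0) (𝓝 (G x * ∫ z, k z)) := by
  rw [← integral_const_mul]
  refine tendsto_integral_filter_of_dominated_convergence (fun z => ‖k z‖ * M)
    (.of_forall fun h => (integrable_mul_comp_sub_mul hk hG hM x h).1)
    (.of_forall fun h => ae_of_all _ fun z => ?_) (hk.norm.mul_const M) (ae_of_all _ fun z => ?_)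
  · rw [norm_mul]
    gcongr
    exact hM _
  · have hshift : Tendsto (fun h => x - h * z) (𝓝 0) (𝓝 x) :=
      Continuous.tendsto' (by fun_prop) _ _ (by simp)
    rw [mul_comm]
    exact (hx.tendsto.comp hshift).const_mul _

theorem tendsto_integral_sq_mul_taylorQuotient (hK : Integrable fun z => z ^ 2 * K z)
    (hG : Measurable G) (hM : ∀ s, |G s| ≤ M) (hx : TwiceDifferentiableAt G x) :
    Tendsto (fun h => ∫ z, z ^ 2 * K z * taylorQuotient G x (-h * z)) (𝓝[≠] 0)
      (𝓝 (deriv (deriv G) x / 2 * kernelMoment K 2)) := by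
  obtain ⟨C, hC⟩ := hx.exists_abs_taylorQuotient_le hM
  have hmeas : Measurable (taylorQuotient G x) := by
    have : Measurable fun y => G (x + y) := hG.comp (by fun_prop)
    unfold taylorQuotient
    fun_prop
  rw [kernelMoment, ← integral_const_mul]
  refine tendsto_integral_filter_of_dominated_convergence (fun z => ‖z ^ 2 * K z‖ * C)
    (.of_forall fun h => hK.1.mul (hmeas.comp (by fun_prop)).aestronglyMeasurable)
    (.of_forall fun h => ae_of_all _ fun z => ?_) (hK.norm.mul_const C) ?_
  · rw [norm_mul]
    gcongr
    exact hC _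
  · filter_upwards [compl_mem_ae_iff.2 (measure_singleton (0 : ℝ))] with z (hz : z ≠ 0)
    have hscale : Tendsto (fun h : ℝ => -h * z) (𝓝[≠] 0) (𝓝[≠] 0) := by
      refine tendsto_nhdsWithin_iff.2
        ⟨(Continuous.tendsto' (by fun_prop) _ _ (by simp)).mono_left nhdsWithin_le_nhds, ?_⟩
      filter_upwards [self_mem_nhdsWithin] with h hh using mul_ne_zero (neg_ne_zero.2 hh) hz
    rw [mul_comm (deriv (deriv G) x / 2)]
    exact (hx.tendsto_taylorQuotient.comp hscale).const_mul _

namespace IsSecondOrderKernel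

theorem tendsto_smooth_sub_div (hK : IsSecondOrderKernel K) (hG : Measurable G)
    (hM : ∀ s, |G s| ≤ M) (hx : TwiceDifferentiableAt G x) :
    Tendsto (fun h => (smooth K G x h - G x) / h ^ 2) (𝓝[≠] 0)
      (𝓝 (deriv (deriv G) x / 2 * kernelMoment K 2)) := by
  refine (tendsto_integral_sq_mul_taylorQuotient hK.integrable_two hG hM hx).congr' ?_
  filter_upwards [self_mem_nhdsWithin] with h (hh : h ≠ 0)
  have hexpand : ∀ z, z ^ 2 * K z * taylorQuotient G x (-h * z) =
      (h ^ 2)⁻¹ * (K z * G (x - h * z) - G x * K z + deriv G x * h * (z * K z)) := fun z => by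
    rcases eq_or_ne z 0 with rfl | hz
    · simp [mul_comm]
    · simp only [taylorQuotient, neg_mul, ← sub_eq_add_neg]
      field_simp
      ring
  have hint := integrable_mul_comp_sub_mul hK.integrable hG hM x h
  have hint0 : Integrable fun z => G x * K z := hK.integrable.const_mul _
  have hint1 : Integrable fun z => deriv G x * h * (z * K z) := hK.integrable_one.const_mul _
  simp_rw [hexpand]
  rw [integral_const_mul, integral_add (f := fun z => _ - _) (hint.sub hint0) hint1,
    integral_sub hint hint0, integral_const_mul, integral_const_mul, hK.integral_eq_one,
    hK.integral_one, smooth]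
  ring

theorem integrable_abs_pow_three (hK : IsSecondOrderKernel K) :
    Integrable fun z => |K z| ^ 3 :=
  hK.memLp_three.integrable_norm_pow (p := 3) three_ne_zero

theorem integrable_sq (hK : IsSecondOrderKernel K) : Integrable fun z => K z ^ 2 := by
  refine (hK.integrable.norm.add hK.integrable_abs_pow_three).mono'
    (hK.measurable.pow_const 2).aestronglyMeasurable (ae_of_all _ fun z => ?_)
  simp only [norm_pow, Real.norm_eq_abs, Pi.add_apply]
  nlinarith [mul_nonneg (abs_nonneg (K z)) (sq_nonneg (|K z| - 1)), abs_nonneg (K z)]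

end IsSecondOrderKernel

theorem KernelAssumption.isSecondOrderKernel (hK : KernelAssumption K) :
    IsSecondOrderKernel K where
  measurable := hK.continuous.measurable
  integrable := hK.integrable
  integral_eq_one := hK.integral_eq_one
  integrable_one := hK.integrable_one
  integral_one := hK.integral_one
  integrable_two := hK.integrable_two
  memLp_three := by
    obtain ⟨M, hM⟩ := hK.bounded
    refine (integrable_norm_rpow_iff hK.integrable.1 three_ne_zero ENNReal.ofNat_ne_top).1 ?_
    refine (hK.integrable.norm.mul_bdd (c := M ^ 2) (hK.integrable.norm.1.pow 2)
      (ae_of_all _ fun z => ?_)).congr (ae_of_all _ fun z => ?_)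
    · simpa using pow_le_pow_left₀ (abs_nonneg _) (hM z) 2
    · simp only [ENNReal.toReal_ofNat, Real.rpow_ofNat, Pi.pow_apply]
      ring

end Smoothing

section WeightedMarginal

/-- The weighted marginal `s ↦ ∫ φ(t) g(s, t) dt`, that is `E[φ(Y) | X = s] f(s)`: the marginal for
`φ = 1` and the function `a` for `φ(t) = t`. -/
def weightedMarginal (g : ℝ → ℝ → ℝ) (φ : ℝ → ℝ) (s : ℝ) : ℝ := ∫ t, φ t * g s t

/-- The functions `t ↦ φ(t) g(s, t)` are bounded in `L¹`, uniformly in `s` (when `g ≥ 0`). -/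
structure HasBoundedMoment (g : ℝ → ℝ → ℝ) (φ : ℝ → ℝ) : Prop where
  integrable : ∀ s, Integrable fun t => φ t * g s t
  bounded : ∃ M, ∀ s, ∫ t, |φ t| * g s t ≤ M

variable {g : ℝ → ℝ → ℝ} {φ ψ χ k : ℝ → ℝ}

theorem measurable_weightedMarginal (hg : Measurable (Function.uncurry g)) (hφ : Measurable φ) :
    Measurable (weightedMarginal g φ) :=
  ((hφ.comp measurable_snd).mul hg).stronglyMeasurable.integral_prod_right.measurable

namespace HasBoundedMoment

theorem exists_abs_weightedMarginal_le (hφ : HasBoundedMoment g φ) (hg : ∀ s t, 0 ≤ g s t) :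
    ∃ M, ∀ s, |weightedMarginal g φ s| ≤ M := by
  obtain ⟨M, hM⟩ := hφ.bounded
  refine ⟨M, fun s => abs_integral_le_integral_abs.trans ?_⟩
  simpa only [abs_mul, abs_of_nonneg (hg s _)] using hM s

theorem integrable_abs_mul (hφ : HasBoundedMoment g φ) (hg : ∀ s t, 0 ≤ g s t) (s : ℝ) :
    Integrable fun t => |φ t| * g s t := by
  simpa only [norm_mul, Real.norm_eq_abs, abs_of_nonneg (hg s _)] using (hφ.integrable s).norm

theorem of_abs_le (hφ : HasBoundedMoment g φ) (hψ : HasBoundedMoment g ψ) (hχ : Measurable χ)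
    (hg : Measurable (Function.uncurry g)) (h0 : ∀ s t, 0 ≤ g s t)
    (hle : ∀ t, |χ t| ≤ |φ t| + |ψ t|) : HasBoundedMoment g χ := by
  have hint : ∀ s, Integrable fun t => |φ t| * g s t + |ψ t| * g s t := fun s =>
    (hφ.integrable_abs_mul h0 s).add (hψ.integrable_abs_mul h0 s)
  have hbound : ∀ s t, |χ t| * g s t ≤ |φ t| * g s t + |ψ t| * g s t := fun s t => by
    rw [← add_mul]
    exact mul_le_mul_of_nonneg_right (hle t) (h0 s t)
  obtain ⟨M, hM⟩ := hφ.bounded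
  obtain ⟨N, hN⟩ := hψ.bounded
  refine ⟨fun s => (hint s).mono' (hχ.mul hg.of_uncurry_left).aestronglyMeasurable
    (ae_of_all _ fun t => ?_), M + N, fun s => ?_⟩
  · rw [norm_mul, Real.norm_eq_abs, Real.norm_of_nonneg (h0 s t)]
    exact hbound s t
  calc ∫ t, |χ t| * g s t ≤ ∫ t, (|φ t| * g s t + |ψ t| * g s t) :=
        integral_mono_of_nonneg (ae_of_all _ fun t => mul_nonneg (abs_nonneg _) (h0 s t)) (hint s)
          (ae_of_all _ (hbound s))
    _ = (∫ t, |φ t| * g s t) + ∫ t, |ψ t| * g s t :=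
        integral_add (hφ.integrable_abs_mul h0 s) (hψ.integrable_abs_mul h0 s)
    _ ≤ M + N := add_le_add (hM s) (hN s)

theorem integrable_prod (hφ : HasBoundedMoment g φ) (hφm : Measurable φ)
    (hg : Measurable (Function.uncurry g)) (h0 : ∀ s t, 0 ≤ g s t) (hkm : Measurable k)
    (hk : Integrable k) :
    Integrable (fun v : ℝ × ℝ => k v.1 * (φ v.2 * g v.1 v.2)) (volume.prod volume) := by
  obtain ⟨M, hM⟩ := hφ.bounded
  have hm : Measurable fun v : ℝ × ℝ => k v.1 * (φ v.2 * g v.1 v.2) :=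
    (hkm.comp measurable_fst).mul ((hφm.comp measurable_snd).mul hg)
  refine (integrable_prod_iff hm.aestronglyMeasurable).2
    ⟨ae_of_all _ fun s => (hφ.integrable s).const_mul (k s), ?_⟩
  refine (hk.norm.mul_const M).mono'
    hm.norm.stronglyMeasurable.integral_prod_right'.aestronglyMeasurable (ae_of_all _ fun s => ?_)
  simp_rw [norm_mul, Real.norm_of_nonneg (h0 s _), integral_const_mul, Real.norm_eq_abs]
  rw [abs_mul, abs_abs, abs_of_nonneg (integral_nonneg fun t => mul_nonneg (abs_nonneg _) (h0 s t))]
  gcongr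
  exact hM s

end HasBoundedMoment

end WeightedMarginal

section Sample

variable {Ω : Type*} [MeasurableSpace Ω] {P : Measure Ω} {X Y : ℕ → Ω → ℝ} {g : ℝ → ℝ → ℝ}
  {k φ : ℝ → ℝ} {n : ℕ}

namespace IsSample

theorem integrable_comp_iff (H : IsSample P X Y g) (hn : 1 ≤ n) {Φ : ℝ × ℝ → ℝ}
    (hΦ : Measurable Φ) :
    Integrable (fun ω => Φ (X n ω, Y n ω)) P ↔
      Integrable (fun v => g v.1 v.2 * Φ v) (volume.prod volume) := by
  have hXY := (H.measurable_X n hn).prodMk (H.measurable_Y n hn)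
  have hdens : Measurable fun v : ℝ × ℝ => ENNReal.ofReal (g v.1 v.2) :=
    H.measurable_density.ennreal_ofReal
  rw [← Function.comp_def Φ, ← integrable_map_measure hΦ.aestronglyMeasurable hXY.aemeasurable,
    H.law n hn, integrable_withDensity_iff_integrable_smul' hdens
      (ae_of_all _ fun _ => ENNReal.ofReal_lt_top)]
  simp only [ENNReal.toReal_ofReal (H.density_nonneg _ _), smul_eq_mul]
  rfl

theorem integral_comp (H : IsSample P X Y g) (hn : 1 ≤ n) {Φ : ℝ × ℝ → ℝ} (hΦ : Measurable Φ) :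
    ∫ ω, Φ (X n ω, Y n ω) ∂P = ∫ v, g v.1 v.2 * Φ v ∂(volume.prod volume) := by
  have hXY := (H.measurable_X n hn).prodMk (H.measurable_Y n hn)
  have hdens : Measurable fun v : ℝ × ℝ => ENNReal.ofReal (g v.1 v.2) :=
    H.measurable_density.ennreal_ofReal
  rw [← integral_map hXY.aemeasurable hΦ.aestronglyMeasurable, H.law n hn,
    integral_withDensity_eq_integral_toReal_smul hdens
      (ae_of_all _ fun _ => ENNReal.ofReal_lt_top)]
  simp only [ENNReal.toReal_ofReal (H.density_nonneg _ _), smul_eq_mul]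
  rfl

theorem integrable_mul (H : IsSample P X Y g) (hn : 1 ≤ n) (hkm : Measurable k)
    (hk : Integrable k) (hφm : Measurable φ) (hφ : HasBoundedMoment g φ) :
    Integrable (fun ω => k (X n ω) * φ (Y n ω)) P := by
  refine (H.integrable_comp_iff hn (Φ := fun v => k v.1 * φ v.2) (by fun_prop)).2
    ((hφ.integrable_prod hφm H.measurable_density H.density_nonneg hkm hk).congr
      (ae_of_all _ fun v => ?_))
  ring

theorem integral_mul (H : IsSample P X Y g) (hn : 1 ≤ n) (hkm : Measurable k)
    (hk : Integrable k) (hφm : Measurable φ) (hφ : HasBoundedMoment g φ) :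
    ∫ ω, k (X n ω) * φ (Y n ω) ∂P = ∫ s, k s * weightedMarginal g φ s := by
  have hprod := hφ.integrable_prod hφm H.measurable_density H.density_nonneg hkm hk
  have hcomm : ∀ v : ℝ × ℝ, g v.1 v.2 * (k v.1 * φ v.2) = k v.1 * (φ v.2 * g v.1 v.2) :=
    fun v => by ring
  rw [H.integral_comp hn (Φ := fun v => k v.1 * φ v.2) (by fun_prop)]
  simp_rw [hcomm]
  rw [integral_prod _ hprod]
  simp_rw [integral_const_mul]
  rfl

variable {h : ℝ}

theorem integrable_kernel_mul (H : IsSample P X Y g) (hn : 1 ≤ n) (hkm : Measurable k)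
    (hk : Integrable k) (hφm : Measurable φ) (hφ : HasBoundedMoment g φ) (hh : 0 < h) (x : ℝ) :
    Integrable (fun ω => k (h⁻¹ * (x - X n ω)) * φ (Y n ω)) P :=
  H.integrable_mul (k := fun s => k (h⁻¹ * (x - s))) hn (hkm.comp (by fun_prop))
    ((hk.comp_mul_left' (inv_ne_zero hh.ne')).comp_sub_left x) hφm hφ

theorem integral_kernel_mul (H : IsSample P X Y g) (hn : 1 ≤ n) (hkm : Measurable k)
    (hk : Integrable k) (hφm : Measurable φ) (hφ : HasBoundedMoment g φ) (hh : 0 < h) (x : ℝ) :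
    ∫ ω, k (h⁻¹ * (x - X n ω)) * φ (Y n ω) ∂P = h * smooth k (weightedMarginal g φ) x h := by
  rw [H.integral_mul (k := fun s => k (h⁻¹ * (x - s))) hn (hkm.comp (by fun_prop))
    ((hk.comp_mul_left' (inv_ne_zero hh.ne')).comp_sub_left x) hφm hφ]
  have hsub := integral_sub_left_eq_self (μ := volume)
    (fun u => k (h⁻¹ * u) * weightedMarginal g φ (x - u)) x
  have hscale := Measure.integral_comp_mul_left
    (fun u => k (h⁻¹ * u) * weightedMarginal g φ (x - u)) h
  simp only [sub_sub_cancel] at hsub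
  simp only [inv_mul_cancel_left₀ hh.ne', abs_of_pos (inv_pos.2 hh), smul_eq_mul] at hscale
  rw [hsub, smooth, hscale, mul_inv_cancel_left₀ hh.ne']

end IsSample
end Sample

section KernelObs

variable {Ω : Type*} {X Y : ℕ → Ω → ℝ} {g : ℝ → ℝ → ℝ} {K φ ψ : ℝ → ℝ} {h : ℕ → ℝ} {n : ℕ} {x : ℝ}

/-- The contribution of the `n`-th observation to the kernel estimator of `weightedMarginal g φ x`:
the estimators `f_n(x)` and `a_n(x)` are the recursive averages for `φ = 1` and `φ(t) = t`. -/
def kernelObs (K φ : ℝ → ℝ) (h : ℕ → ℝ) (X Y : ℕ → Ω → ℝ) (x : ℝ) (n : ℕ) (ω : Ω) : ℝ :=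
  (h n)⁻¹ * (K ((h n)⁻¹ * (x - X n ω)) * φ (Y n ω))

theorem abs_kernelObs_pow_three (hh : 0 < h n) (ω : Ω) : |kernelObs K φ h X Y x n ω| ^ 3 =
    (h n)⁻¹ ^ 3 * (|K ((h n)⁻¹ * (x - X n ω))| ^ 3 * |φ (Y n ω)| ^ 3) := by
  rw [kernelObs, abs_mul, abs_mul, abs_of_pos (inv_pos.2 hh)]
  ring

/-- The weights `φ` for which the recursive estimator of `weightedMarginal g φ` obeys Lyapunov's
condition. -/
structure IsAdmissibleWeight (g : ℝ → ℝ → ℝ) (φ : ℝ → ℝ) : Prop where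
  measurable : Measurable φ
  one : HasBoundedMoment g fun _ => 1
  cube : HasBoundedMoment g fun t => |φ t| ^ 3

namespace IsAdmissibleWeight

theorem hasBoundedMoment (hφ : IsAdmissibleWeight g φ) (hg : Measurable (Function.uncurry g))
    (h0 : ∀ s t, 0 ≤ g s t) : HasBoundedMoment g φ := by
  refine hφ.one.of_abs_le hφ.cube hφ.measurable hg h0 fun t => ?_
  rw [abs_one, abs_pow, abs_abs]
  nlinarith [mul_nonneg (abs_nonneg (φ t)) (sq_nonneg (|φ t| - 1)), sq_nonneg (|φ t| - 1),
    abs_nonneg (φ t)]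

theorem hasBoundedMoment_mul (hφ : IsAdmissibleWeight g φ) (hψ : IsAdmissibleWeight g ψ)
    (hg : Measurable (Function.uncurry g)) (h0 : ∀ s t, 0 ≤ g s t) :
    HasBoundedMoment g fun t => φ t * ψ t := by
  have hsq : ∀ {θ}, IsAdmissibleWeight g θ → HasBoundedMoment g fun t => θ t ^ 2 := fun {θ} hθ => by
    refine hθ.one.of_abs_le hθ.cube (hθ.measurable.pow_const 2) hg h0 fun t => ?_
    rw [abs_one, abs_pow, abs_pow, abs_abs]
    nlinarith [mul_nonneg (abs_nonneg (θ t)) (sq_nonneg (|θ t| - 1)), sq_nonneg (|θ t| - 1),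
      abs_nonneg (θ t)]
  refine (hsq hφ).of_abs_le (hsq hψ) (hφ.measurable.mul hψ.measurable) hg h0 fun t => ?_
  rw [abs_mul, abs_pow, abs_pow]
  nlinarith [sq_nonneg (|φ t| - |ψ t|), mul_nonneg (abs_nonneg (φ t)) (abs_nonneg (ψ t))]

end IsAdmissibleWeight

variable [MeasurableSpace Ω] {P : Measure Ω}

theorem measurable_kernelObs (H : IsSample P X Y g) (hn : 1 ≤ n) (hK : Measurable K)
    (hφ : Measurable φ) : Measurable (kernelObs K φ h X Y x n) :=
  ((hK.comp (((H.measurable_X n hn).const_sub x).const_mul _)).mul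
    (hφ.comp (H.measurable_Y n hn))).const_mul _

theorem integral_kernelObs (H : IsSample P X Y g) (hn : 1 ≤ n) (hKm : Measurable K)
    (hK : Integrable K) (hφm : Measurable φ) (hφ : HasBoundedMoment g φ) (hh : 0 < h n) :
    ∫ ω, kernelObs K φ h X Y x n ω ∂P = smooth K (weightedMarginal g φ) x (h n) := by
  simp only [kernelObs]
  rw [integral_const_mul, H.integral_kernel_mul hn hKm hK hφm hφ hh, inv_mul_cancel_left₀ hh.ne']

theorem integral_kernelObs_mul (H : IsSample P X Y g) (hn : 1 ≤ n) (hKm : Measurable K)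
    (hK : Integrable fun z => K z ^ 2) (hφm : Measurable φ) (hψm : Measurable ψ)
    (hφψ : HasBoundedMoment g fun t => φ t * ψ t) (hh : 0 < h n) :
    ∫ ω, kernelObs K φ h X Y x n ω * kernelObs K ψ h X Y x n ω ∂P =
      (h n)⁻¹ * smooth (fun z => K z ^ 2) (weightedMarginal g fun t => φ t * ψ t) x (h n) := by
  have hprod : ∀ ω, kernelObs K φ h X Y x n ω * kernelObs K ψ h X Y x n ω =
      (h n)⁻¹ ^ 2 * (K ((h n)⁻¹ * (x - X n ω)) ^ 2 * (φ (Y n ω) * ψ (Y n ω))) := fun ω => by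
    simp only [kernelObs]
    ring
  simp_rw [hprod]
  rw [integral_const_mul, H.integral_kernel_mul hn (hKm.pow_const 2) hK
    (φ := fun t => φ t * ψ t) (hφm.mul hψm) hφψ hh, sq, mul_assoc, inv_mul_cancel_left₀ hh.ne']

theorem memLp_kernelObs (H : IsSample P X Y g) (hn : 1 ≤ n) (hK : IsSecondOrderKernel K)
    (hφ : IsAdmissibleWeight g φ) (hh : 0 < h n) : MemLp (kernelObs K φ h X Y x n) 3 P := by
  have hm := measurable_kernelObs (h := h) (x := x) H hn hK.measurable hφ.measurable
  refine (integrable_norm_rpow_iff hm.aestronglyMeasurable three_ne_zero ENNReal.ofNat_ne_top).1 ?_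
  simp only [ENNReal.toReal_ofNat, Real.rpow_ofNat, Real.norm_eq_abs, abs_kernelObs_pow_three hh]
  exact (H.integrable_kernel_mul (k := fun z => |K z| ^ 3) (φ := fun t => |φ t| ^ 3) hn
    (hK.measurable.abs.pow_const 3) hK.integrable_abs_pow_three (hφ.measurable.abs.pow_const 3)
    hφ.cube hh x).const_mul _

theorem exists_integral_abs_kernelObs_pow_three_le (H : IsSample P X Y g)
    (hK : IsSecondOrderKernel K) (hφ : IsAdmissibleWeight g φ) (x : ℝ) :
    ∃ C, ∀ n, 1 ≤ n → 0 < h n → h n ^ 2 * ∫ ω, |kernelObs K φ h X Y x n ω| ^ 3 ∂P ≤ C := by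
  obtain ⟨M, hM⟩ := hφ.cube.exists_abs_weightedMarginal_le H.density_nonneg
  refine ⟨M * ∫ z, |(|K z| ^ 3)|, fun n hn hh => ?_⟩
  simp_rw [abs_kernelObs_pow_three hh]
  rw [integral_const_mul, H.integral_kernel_mul (k := fun z => |K z| ^ 3) (φ := fun t => |φ t| ^ 3)
    hn (hK.measurable.abs.pow_const 3) hK.integrable_abs_pow_three
    (hφ.measurable.abs.pow_const 3) hφ.cube hh x]
  calc _ = smooth (fun z => |K z| ^ 3) (weightedMarginal g fun t => |φ t| ^ 3) x (h n) := by
        field_simp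
    _ ≤ _ := (le_abs_self _).trans (abs_smooth_le hK.integrable_abs_pow_three hM x (h n))

theorem tendsto_integral_kernelObs_sub_div (H : IsSample P X Y g) (hK : IsSecondOrderKernel K)
    (hφ : IsAdmissibleWeight g φ) (hh : Tendsto h atTop (𝓝[>] 0))
    (hx : TwiceDifferentiableAt (weightedMarginal g φ) x) :
    Tendsto (fun n => (∫ ω, kernelObs K φ h X Y x n ω ∂P - weightedMarginal g φ x) / h n ^ 2) atTop
      (𝓝 (deriv (deriv (weightedMarginal g φ)) x / 2 * kernelMoment K 2)) := by
  have hφg := hφ.hasBoundedMoment H.measurable_density H.density_nonneg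
  obtain ⟨M, hM⟩ := hφg.exists_abs_weightedMarginal_le H.density_nonneg
  refine ((hK.tendsto_smooth_sub_div (measurable_weightedMarginal H.measurable_density
    hφ.measurable) hM hx).comp (hh.mono_right (nhdsGT_le_nhdsNE 0))).congr' ?_
  filter_upwards [eventually_ge_atTop 1, hh.eventually self_mem_nhdsWithin] with n hn hhn
  rw [integral_kernelObs H hn hK.measurable hK.integrable hφ.measurable hφg hhn,
    Function.comp_apply]

theorem mul_covariance_kernelObs [IsProbabilityMeasure P] (H : IsSample P X Y g) (hn : 1 ≤ n)
    (hK : IsSecondOrderKernel K) (hφ : IsAdmissibleWeight g φ) (hψ : IsAdmissibleWeight g ψ)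
    (hh : 0 < h n) :
    h n * cov[kernelObs K φ h X Y x n, kernelObs K ψ h X Y x n; P] =
      smooth (fun z => K z ^ 2) (weightedMarginal g fun t => φ t * ψ t) x (h n) -
        smooth K (weightedMarginal g φ) x (h n) * smooth K (weightedMarginal g ψ) x (h n) *
          h n := by
  have hg := H.measurable_density
  have h0 := H.density_nonneg
  rw [covariance_eq_sub ((memLp_kernelObs H hn hK hφ hh).mono_exponent (by norm_num))
    ((memLp_kernelObs H hn hK hψ hh).mono_exponent (by norm_num)),
    integral_kernelObs H hn hK.measurable hK.integrable hφ.measurable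
      (hφ.hasBoundedMoment hg h0) hh,
    integral_kernelObs H hn hK.measurable hK.integrable hψ.measurable
      (hψ.hasBoundedMoment hg h0) hh]
  simp only [Pi.mul_apply]
  rw [integral_kernelObs_mul H hn hK.measurable hK.integrable_sq hφ.measurable hψ.measurable
    (hφ.hasBoundedMoment_mul hψ hg h0) hh]
  field_simp

theorem tendsto_mul_covariance_kernelObs [IsProbabilityMeasure P] (H : IsSample P X Y g)
    (hK : IsSecondOrderKernel K) (hφ : IsAdmissibleWeight g φ) (hψ : IsAdmissibleWeight g ψ)
    (hh : Tendsto h atTop (𝓝[>] 0))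
    (hx : ContinuousAt (weightedMarginal g fun t => φ t * ψ t) x) :
    Tendsto (fun n => h n * cov[kernelObs K φ h X Y x n, kernelObs K ψ h X Y x n; P]) atTop
      (𝓝 (weightedMarginal g (fun t => φ t * ψ t) x * kernelR K)) := by
  have hg := H.measurable_density
  have h0 := H.density_nonneg
  obtain ⟨M, hM⟩ := (hφ.hasBoundedMoment hg h0).exists_abs_weightedMarginal_le h0
  obtain ⟨N, hN⟩ := (hψ.hasBoundedMoment hg h0).exists_abs_weightedMarginal_le h0
  obtain ⟨L, hL⟩ := (hφ.hasBoundedMoment_mul hψ hg h0).exists_abs_weightedMarginal_le h0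
  have hh0 : Tendsto h atTop (𝓝 0) := hh.mono_right nhdsWithin_le_nhds
  have hsecond := (tendsto_smooth hK.integrable_sq
    (measurable_weightedMarginal hg (hφ.measurable.mul hψ.measurable)) hL hx).comp hh0
  have hmeans : Tendsto (fun n => smooth K (weightedMarginal g φ) x (h n) *
      smooth K (weightedMarginal g ψ) x (h n) * h n) atTop (𝓝 0) := by
    refine bdd_le_mul_tendsto_zero' ((M * ∫ z, |K z|) * (N * ∫ z, |K z|))
      (.of_forall fun n => ?_) hh0
    rw [abs_mul]
    exact mul_le_mul (abs_smooth_le hK.integrable hM _ _) (abs_smooth_le hK.integrable hN _ _)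
      (abs_nonneg _) ((abs_nonneg _).trans (abs_smooth_le hK.integrable hM x 0))
  rw [kernelR, ← sub_zero (_ * _)]
  refine (hsecond.sub hmeans).congr' ?_
  filter_upwards [eventually_ge_atTop 1, hh.eventually self_mem_nhdsWithin] with n hn hhn
  exact (mul_covariance_kernelObs H hn hK hφ hψ hhn).symm

end KernelObs

section Rates

variable {m p q u C T : ℕ → ℝ} {c μ ξ ρ L : ℝ}

theorem recAvg_sub_const (p u : ℕ → ℝ) (c : ℝ) {n : ℕ} (hn : 1 ≤ n) :
    recAvg p u n - c = recSeq (fun n => 1 - p n)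
      (fun n => p n * (u n - c) - if n = 1 then (1 - p 1) * c else 0) n := by
  induction n, hn using Nat.le_induction with
  | base => simp only [recAvg, recSeq, zero_add, if_true]; ring
  | succ n hn ih =>
    simp only [recAvg, recSeq] at ih ⊢
    rw [← ih, if_neg (by lia)]
    ring

namespace GS

theorem tendsto_recAvg_sub_div (hm : GS m (-μ)) (hp : IsStepsize p ξ) (hμ : μ * ξ < 1)
    (hu : Tendsto (fun n => (u n - c) / m n) atTop (𝓝 L)) :
    Tendsto (fun n => (recAvg p u n - c) / m n) atTop (𝓝 (L / (1 - μ * ξ))) := by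
  refine (hm.tendsto_recSeq_div hp (q := fun n => 1 - p n)
    (f := fun n => p n * (u n - c) - if n = 1 then (1 - p 1) * c else 0)
    (tendsto_const_nhds.congr' ?_) hμ (hu.congr' ?_)).congr' ?_
  · filter_upwards [eventually_ge_atTop 1] with n hn
    rw [sub_sub_cancel, div_self (hp.pos n hn).ne']
  · filter_upwards [eventually_ge_atTop 2] with n hn
    rw [if_neg (by lia), sub_zero, mul_div_mul_left _ _ (hp.pos n (by lia)).ne']
  · filter_upwards [eventually_ge_atTop 1] with n hn
    rw [recAvg_sub_const p u c hn]

theorem tendsto_recSeq_mul_div_sq (hm : GS m (-μ)) (hp : IsStepsize p ξ)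
    (hq : Tendsto q atTop (𝓝 0)) (hρ : Tendsto (fun n => q n / p n) atTop (𝓝 ρ))
    (hμ : 2 * μ * ξ < 1 + ρ) (hC : Tendsto (fun n => q n * C n / m n ^ 2) atTop (𝓝 L)) :
    Tendsto (fun n => recSeq (fun n => (1 - p n) * (1 - q n)) (fun n => p n * q n * C n) n /
      m n ^ 2) atTop (𝓝 (L / (1 + ρ - 2 * μ * ξ))) := by
  have hm2 : GS (fun n => m n ^ 2) (-(2 * μ)) := by simpa using hm.pow 2
  refine hm2.tendsto_recSeq_div hp ?_ hμ (hC.congr' ?_)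
  · have hdrift := (hρ.const_add 1).sub hq
    rw [sub_zero] at hdrift
    refine hdrift.congr' ?_
    filter_upwards [eventually_ge_atTop 1] with n hn
    have := (hp.pos n hn).ne'
    field_simp
    ring
  · filter_upwards [eventually_ge_atTop 1] with n hn
    rw [mul_assoc, mul_div_mul_left _ _ (hp.pos n hn).ne']

theorem tendsto_recSeq_abs_pow_three_div (hm : GS m (-μ)) (hp : IsStepsize p ξ) (hμ : μ * ξ < 1)
    (hT : Tendsto (fun n => p n ^ 2 * T n / m n ^ 3) atTop (𝓝 0)) :
    Tendsto (fun n => recSeq (fun n => |1 - p n| ^ 3) (fun n => |p n| ^ 3 * T n) n / |m n| ^ 3)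
      atTop (𝓝 0) := by
  have hm3 : GS (fun n => m n ^ 3) (-(3 * μ)) := by simpa using hm.pow 3
  have hlim := hm3.tendsto_recSeq_div hp (q := fun n => |1 - p n| ^ 3)
    (f := fun n => |p n| ^ 3 * T n) (c₀ := 3) ?_ (by linarith) (hT.congr' ?_)
  · rw [zero_div] at hlim
    refine hlim.congr' ?_
    filter_upwards [eventually_ge_atTop 1] with n hn
    rw [abs_of_pos (hm.1 n hn)]
  · have hdrift : Tendsto (fun n => 3 - 3 * p n + p n ^ 2) atTop (𝓝 3) := by
      simpa using ((hp.tendsto_zero.const_mul 3).const_sub 3).add (hp.tendsto_zero.pow 2)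
    refine hdrift.congr' ?_
    filter_upwards [eventually_ge_atTop 1, hp.tendsto_zero.eventually_le_const one_pos] with n hn h1
    have := (hp.pos n hn).ne'
    rw [abs_of_nonneg (sub_nonneg.2 h1)]
    field_simp
    ring
  · filter_upwards [eventually_ge_atTop 1] with n hn
    have := (hp.pos n hn).ne'
    rw [abs_of_pos (hp.pos n hn)]
    field_simp

end GS

end Rates

section KernelLimits

variable {Ω : Type*} [MeasurableSpace Ω] {P : Measure Ω} {X Y : ℕ → Ω → ℝ}
  {g : ℝ → ℝ → ℝ} {K φ ψ : ℝ → ℝ} {h m p q : ℕ → ℝ} {x μ ξ θ ρ lam : ℝ}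

theorem tendsto_recAvg_integral_kernelObs (H : IsSample P X Y g) (hK : IsSecondOrderKernel K)
    (hφ : IsAdmissibleWeight g φ) (hx : TwiceDifferentiableAt (weightedMarginal g φ) x)
    (hh : Tendsto h atTop (𝓝[>] 0)) (hm : GS m (-μ)) (hp : IsStepsize p ξ) (hμ : μ * ξ < 1)
    (hθ : Tendsto (fun n => h n ^ 2 / m n) atTop (𝓝 θ)) :
    Tendsto (fun n => (recAvg p (fun k => ∫ ω, kernelObs K φ h X Y x k ω ∂P) n -
      weightedMarginal g φ x) / m n) atTop
      (𝓝 (θ * (deriv (deriv (weightedMarginal g φ)) x / 2 * kernelMoment K 2) / (1 - μ * ξ))) := by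
  refine hm.tendsto_recAvg_sub_div hp hμ
    ((hθ.mul (tendsto_integral_kernelObs_sub_div H hK hφ hh hx)).congr' ?_)
  filter_upwards [hh.eventually self_mem_nhdsWithin] with n hn
  have : h n ≠ 0 := (Set.mem_Ioi.1 hn).ne'
  field_simp

theorem tendsto_recSeq_covariance_kernelObs [IsProbabilityMeasure P] (H : IsSample P X Y g)
    (hK : IsSecondOrderKernel K) (hφ : IsAdmissibleWeight g φ) (hψ : IsAdmissibleWeight g ψ)
    (hx : ContinuousAt (weightedMarginal g fun t => φ t * ψ t) x)
    (hh : Tendsto h atTop (𝓝[>] 0)) (hm : GS m (-μ)) (hp : IsStepsize p ξ)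
    (hq : Tendsto q atTop (𝓝 0)) (hρ : Tendsto (fun n => q n / p n) atTop (𝓝 ρ))
    (hμ : 2 * μ * ξ < 1 + ρ)
    (hlam : Tendsto (fun n => q n * (h n)⁻¹ / m n ^ 2) atTop (𝓝 lam)) :
    Tendsto (fun n => recSeq (fun n => (1 - p n) * (1 - q n)) (fun n => p n * q n *
      cov[kernelObs K φ h X Y x n, kernelObs K ψ h X Y x n; P]) n / m n ^ 2) atTop
      (𝓝 (lam * (weightedMarginal g (fun t => φ t * ψ t) x * kernelR K) /
        (1 + ρ - 2 * μ * ξ))) := by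
  refine hm.tendsto_recSeq_mul_div_sq hp hq hρ hμ
    ((hlam.mul (tendsto_mul_covariance_kernelObs H hK hφ hψ hh hx)).congr' ?_)
  filter_upwards [hh.eventually self_mem_nhdsWithin] with n hn
  have : h n ≠ 0 := (Set.mem_Ioi.1 hn).ne'
  field_simp

theorem tendsto_recSeq_integral_abs_kernelObs_pow_three (H : IsSample P X Y g)
    (hK : IsSecondOrderKernel K) (hφ : IsAdmissibleWeight g φ) (hh : Tendsto h atTop (𝓝[>] 0))
    (hm : GS m (-μ)) (hm0 : Tendsto m atTop (𝓝 0)) (hp : IsStepsize p ξ) (hμ : μ * ξ < 1)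
    (hlam : Tendsto (fun n => p n * (h n)⁻¹ / m n ^ 2) atTop (𝓝 lam)) :
    Tendsto (fun n => recSeq (fun n => |1 - p n| ^ 3)
      (fun n => |p n| ^ 3 * ∫ ω, |kernelObs K φ h X Y x n ω| ^ 3 ∂P) n / |m n| ^ 3) atTop
      (𝓝 0) := by
  obtain ⟨C, hC⟩ := exists_integral_abs_kernelObs_pow_three_le (h := h) H hK hφ x
  have hsmall := (hlam.pow 2).mul hm0
  rw [mul_zero] at hsmall
  refine hm.tendsto_recSeq_abs_pow_three_div hp hμ ((bdd_le_mul_tendsto_zero'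
    (f := fun n => h n ^ 2 * ∫ ω, |kernelObs K φ h X Y x n ω| ^ 3 ∂P) C ?_ hsmall).congr' ?_)
  · filter_upwards [eventually_ge_atTop 1, hh.eventually self_mem_nhdsWithin] with n hn hhn
    rw [abs_of_nonneg (by positivity)]
    exact hC n hn hhn
  · filter_upwards [eventually_ge_atTop 1, hh.eventually self_mem_nhdsWithin] with n hn hhn
    have : h n ≠ 0 := (Set.mem_Ioi.1 hhn).ne'
    have := (hm.1 n hn).ne'
    field_simp

end KernelLimits

section KernelCLT

variable {Ω ι : Type*} [MeasurableSpace Ω] {P : Measure Ω} [IsProbabilityMeasure P] [Fintype ι]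
  {X Y : ℕ → Ω → ℝ} {g : ℝ → ℝ → ℝ} {K : ℝ → ℝ} {φ : ι → ℝ → ℝ} {h m : ℕ → ℝ} {p : ι → ℕ → ℝ}
  {x μ : ℝ} {ξ lam B : ι → ℝ} {S : ι → ι → ℝ}

theorem tendstoInDistribution_sum_recAvg_kernelObs_sub_integral (H : IsSample P X Y g)
    (hK : IsSecondOrderKernel K) (hφ : ∀ i, IsAdmissibleWeight g (φ i))
    (hpos : ∀ n, 1 ≤ n → 0 < h n) (hh : Tendsto h atTop (𝓝[>] 0)) (hm : GS m (-μ))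
    (hm0 : Tendsto m atTop (𝓝 0)) (hp : ∀ i, IsStepsize (p i) (ξ i)) (hμ : ∀ i, μ * ξ i < 1)
    (hlam : ∀ i, Tendsto (fun n => p i n * (h n)⁻¹ / m n ^ 2) atTop (𝓝 (lam i)))
    (hcov : ∀ i j, Tendsto (fun n => recSeq (fun n => (1 - p i n) * (1 - p j n))
      (fun n => p i n * p j n *
        cov[kernelObs K (φ i) h X Y x n, kernelObs K (φ j) h X Y x n; P]) n / m n ^ 2)
      atTop (𝓝 (S i j)))
    (c : ι → ℝ) :
    TendstoInDistribution (fun n ω => (m n)⁻¹ * ∑ i, c i *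
        (recAvg (p i) (fun k => kernelObs K (φ i) h X Y x k ω) n -
          recAvg (p i) (fun k => ∫ ω, kernelObs K (φ i) h X Y x k ω ∂P) n))
      atTop id (fun _ => P) (gaussianReal 0 (∑ i, ∑ j, c i * c j * S i j).toNNReal) := by
  refine tendstoInDistribution_sum_recAvg_sub_integral
    (H.indep.comp (fun n (z : ℝ × ℝ) i =>
      (h (n + 1))⁻¹ * (K ((h (n + 1))⁻¹ * (x - z.1)) * φ i z.2)) fun n => ?_)
    (fun i n => memLp_kernelObs H n.succ_pos hK (hφ i) (hpos _ n.succ_pos)) hcov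
    (fun i => tendsto_recSeq_integral_abs_kernelObs_pow_three H hK (hφ i) hh hm hm0 (hp i) (hμ i)
      (hlam i)) c
  have hKm := hK.measurable
  have hφm := fun i => (hφ i).measurable
  fun_prop

theorem tendstoInDistribution_sum_recAvg_kernelObs (H : IsSample P X Y g)
    (hK : IsSecondOrderKernel K) (hφ : ∀ i, IsAdmissibleWeight g (φ i))
    (hpos : ∀ n, 1 ≤ n → 0 < h n) (hh : Tendsto h atTop (𝓝[>] 0)) (hm : GS m (-μ))
    (hm0 : Tendsto m atTop (𝓝 0)) (hp : ∀ i, IsStepsize (p i) (ξ i)) (hμ : ∀ i, μ * ξ i < 1)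
    (hlam : ∀ i, Tendsto (fun n => p i n * (h n)⁻¹ / m n ^ 2) atTop (𝓝 (lam i)))
    (hcov : ∀ i j, Tendsto (fun n => recSeq (fun n => (1 - p i n) * (1 - p j n))
      (fun n => p i n * p j n *
        cov[kernelObs K (φ i) h X Y x n, kernelObs K (φ j) h X Y x n; P]) n / m n ^ 2)
      atTop (𝓝 (S i j)))
    (hbias : ∀ i, Tendsto (fun n =>
      (recAvg (p i) (fun k => ∫ ω, kernelObs K (φ i) h X Y x k ω ∂P) n -
        weightedMarginal g (φ i) x) / m n) atTop (𝓝 (B i)))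
    (c : ι → ℝ) :
    TendstoInDistribution (fun n ω => (m n)⁻¹ * ∑ i, c i *
        (recAvg (p i) (fun k => kernelObs K (φ i) h X Y x k ω) n - weightedMarginal g (φ i) x))
      atTop id (fun _ => P)
      (gaussianReal (∑ i, c i * B i) (∑ i, ∑ j, c i * c j * S i j).toNNReal) := by
  have hclt := tendstoInDistribution_sum_recAvg_kernelObs_sub_integral H hK hφ hpos hh hm hm0 hp hμ
    hlam hcov c
  have hshift := tendsto_finsetSum Finset.univ fun i _ => (hbias i).const_mul (c i)
  have hsum := hclt.add_of_tendstoInMeasure_const (tendstoInMeasure_const_of_tendsto hshift)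
    fun _ => aemeasurable_const
  have hlaw := gaussianReal_add_const
    (HasLaw.id (μ := gaussianReal 0 (∑ i, ∑ j, c i * c j * S i j).toNNReal)) (∑ i, c i * B i)
  rw [zero_add] at hlaw
  convert tendstoInDistribution_id_of_hasLaw hsum hlaw using 2 with n
  ext ω
  simp only [Pi.add_apply, Finset.mul_sum, ← Finset.sum_add_distrib]
  refine Finset.sum_congr rfl fun i _ => ?_
  ring

end KernelCLT

section Estimators

variable {Ω : Type*} {X Y : ℕ → Ω → ℝ} {g : ℝ → ℝ → ℝ} {K : ℝ → ℝ}
  {stepβ stepγ h m : ℕ → ℝ} {x μ ξ η ρ lam θ : ℝ}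

theorem marginal_eq_weightedMarginal (g : ℝ → ℝ → ℝ) :
    marginal g = weightedMarginal g fun _ => 1 := by
  ext s
  simp only [marginal, weightedMarginal, one_mul]

theorem aFun_eq_weightedMarginal (h1 : HasBoundedMoment g fun _ => 1) (h0 : ∀ s t, 0 ≤ g s t) :
    aFun g = weightedMarginal g fun t => t := by
  ext s
  rw [aFun, regFun, condMoment]
  simp only [pow_one]
  by_cases hs : marginal g s = 0
  · have hg : g s =ᵐ[volume] 0 :=
      (integral_eq_zero_iff_of_nonneg (h0 s) (by simpa using h1.integrable s)).1 hs
    rw [hs, mul_zero, weightedMarginal, integral_eq_zero_of_ae]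
    filter_upwards [hg] with t ht
    rw [ht, Pi.zero_apply, mul_zero]
  · exact div_mul_cancel₀ _ hs

theorem aEst_eq_recAvg (K : ℝ → ℝ) (stepβ h : ℕ → ℝ) (X Y : ℕ → Ω → ℝ) (x : ℝ) (n : ℕ) :
    aEst K stepβ h X Y x n = fun ω =>
      recAvg stepβ (fun k => kernelObs K (fun t => t) h X Y x k ω) n := by
  induction n with
  | zero => rfl
  | succ n ih =>
    ext ω
    simp only [aEst, ih, recAvg, recSeq, kernelObs]
    ring

theorem fEst_eq_recAvg (K : ℝ → ℝ) (stepγ h : ℕ → ℝ) (X Y : ℕ → Ω → ℝ) (x : ℝ) (n : ℕ) :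
    fEst K stepγ h X x n = fun ω =>
      recAvg stepγ (fun k => kernelObs K (fun _ => 1) h X Y x k ω) n := by
  induction n with
  | zero => rfl
  | succ n ih =>
    ext ω
    simp only [fEst, ih, recAvg, recSeq, kernelObs]
    ring

theorem rEst_eq_div (K : ℝ → ℝ) (stepγ stepβ h : ℕ → ℝ) (X Y : ℕ → Ω → ℝ) (x : ℝ) (n : ℕ) (ω : Ω) :
    rEst K stepγ stepβ h X Y x n ω = aEst K stepβ h X Y x n ω / fEst K stepγ h X x n ω := by
  rw [rEst, ite_not]
  split_ifs with h0
  · rw [h0, div_zero]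
  · rfl

/-- Regularity of the joint density at `x`, weaker than `DensityAssumption`: `f` and the absolute
third moment of `Y` are bounded, the second moment is continuous at `x`, and `f` and `a` are twice
differentiable at `x`. -/
structure IsRegularAt (g : ℝ → ℝ → ℝ) (x : ℝ) : Prop where
  one : HasBoundedMoment g fun _ => 1
  cube : HasBoundedMoment g fun t => |t| ^ 3
  continuousAt_sq : ContinuousAt (weightedMarginal g fun t => t ^ 2) x
  marginal : TwiceDifferentiableAt (marginal g) x
  aFun : TwiceDifferentiableAt (aFun g) x

/-- `m` is a scale on which both the noise and the bias of the pair `(a_n(x), f_n(x))` converge: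
`lam` is the limit of the ratio of the noise variance `β_n / h_n` to `m_n²`, and `θ` that of the
ratio of the bias `h_n²` to `m_n`. -/
structure IsNormalization (stepβ stepγ h m : ℕ → ℝ) (μ ξ η ρ lam θ : ℝ) : Prop where
  stepsize_a : IsStepsize stepβ ξ
  stepsize_f : IsStepsize stepγ η
  ratio : Tendsto (fun n => stepγ n / stepβ n) atTop (𝓝 ρ)
  bandwidth_pos : ∀ n, 1 ≤ n → 0 < h n
  bandwidth : Tendsto h atTop (𝓝[>] 0)
  gs : GS m (-μ)
  tendsto_zero : Tendsto m atTop (𝓝 0)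
  noise : Tendsto (fun n => stepβ n * (h n)⁻¹ / m n ^ 2) atTop (𝓝 lam)
  bias : Tendsto (fun n => h n ^ 2 / m n) atTop (𝓝 θ)
  mul_lt_a : μ * ξ < 1
  mul_lt_f : μ * η < 1

/-- The functions of `Y` averaged by `a_n(x)` and by `f_n(x)`. -/
def pairWeight : Fin 2 → ℝ → ℝ := ![fun t => t, fun _ => 1]

/-- The limit of the biases of `(a_n(x), f_n(x))` on the scale of an `IsNormalization`. -/
def pairBias (K : ℝ → ℝ) (g : ℝ → ℝ → ℝ) (μ ξ η θ x : ℝ) : Fin 2 → ℝ :=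
  ![θ * (deriv (deriv (aFun g)) x / 2 * kernelMoment K 2) / (1 - μ * ξ),
    θ * (deriv (deriv (marginal g)) x / 2 * kernelMoment K 2) / (1 - μ * η)]

/-- The limit of the covariance matrices of `(a_n(x), f_n(x))` on the scale of an
`IsNormalization`. -/
def pairCov (K : ℝ → ℝ) (g : ℝ → ℝ → ℝ) (μ ξ η ρ lam x : ℝ) : Matrix (Fin 2) (Fin 2) ℝ :=
  !![lam * (weightedMarginal g (fun t => t ^ 2) x * kernelR K) / (1 + 1 - 2 * μ * ξ),
      lam * ρ * (aFun g x * kernelR K) / (1 + ρ - 2 * μ * ξ);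
    lam * ρ * (aFun g x * kernelR K) / (1 + ρ - 2 * μ * ξ),
      lam * ρ * (marginal g x * kernelR K) / (1 + 1 - 2 * μ * η)]

/-- The coefficients of the linearisation of `(a, f) ↦ a / f`, up to the factor `1 / f(x)`. -/
def ratioCoeff (g : ℝ → ℝ → ℝ) (x : ℝ) : Fin 2 → ℝ := ![1, -regFun g x]

/-- The limit of the bias of `r_n(x)` on the scale of an `IsNormalization`. -/
def ratioBias (K : ℝ → ℝ) (g : ℝ → ℝ → ℝ) (μ ξ η θ x : ℝ) : ℝ :=
  (∑ i, ratioCoeff g x i * pairBias K g μ ξ η θ x i) / marginal g x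

/-- The limit of the variance of `r_n(x)` on the scale of an `IsNormalization`. -/
def ratioVar (K : ℝ → ℝ) (g : ℝ → ℝ → ℝ) (μ ξ η ρ lam x : ℝ) : ℝ :=
  (∑ i, ∑ j, ratioCoeff g x i * ratioCoeff g x j * pairCov K g μ ξ η ρ lam x i j) /
    marginal g x ^ 2

theorem IsRegularAt.isAdmissibleWeight_pairWeight (hg : IsRegularAt g x) (i : Fin 2) :
    IsAdmissibleWeight g (pairWeight i) := by
  fin_cases i
  · exact ⟨measurable_id, hg.one, hg.cube⟩
  · exact ⟨measurable_const, hg.one, by simpa [pairWeight] using hg.one⟩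

theorem IsNormalization.isStepsize (hN : IsNormalization stepβ stepγ h m μ ξ η ρ lam θ)
    (i : Fin 2) : IsStepsize (![stepβ, stepγ] i) (![ξ, η] i) := by
  fin_cases i
  exacts [hN.stepsize_a, hN.stepsize_f]

theorem IsNormalization.mul_lt (hN : IsNormalization stepβ stepγ h m μ ξ η ρ lam θ) (i : Fin 2) :
    μ * ![ξ, η] i < 1 := by
  fin_cases i
  exacts [hN.mul_lt_a, hN.mul_lt_f]

theorem IsNormalization.tendsto_noise_f (hN : IsNormalization stepβ stepγ h m μ ξ η ρ lam θ) :
    Tendsto (fun n => stepγ n * (h n)⁻¹ / m n ^ 2) atTop (𝓝 (lam * ρ)) := by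
  refine (hN.noise.mul hN.ratio).congr' ?_
  filter_upwards [eventually_ge_atTop 1] with n hn
  have := (hN.stepsize_a.pos n hn).ne'
  field_simp

theorem IsNormalization.tendsto_noise (hN : IsNormalization stepβ stepγ h m μ ξ η ρ lam θ)
    (i : Fin 2) : Tendsto (fun n => ![stepβ, stepγ] i n * (h n)⁻¹ / m n ^ 2) atTop
      (𝓝 (![lam, lam * ρ] i)) := by
  fin_cases i
  exacts [hN.noise, hN.tendsto_noise_f]

theorem IsNormalization.two_mul_lt (hN : IsNormalization stepβ stepγ h m μ ξ η ρ lam θ) :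
    2 * μ * ξ < 1 + ρ := by
  have hξ : ξ = ρ * η := by
    refine tendsto_nhds_unique hN.stepsize_a.tendsto_inv
      ((hN.ratio.mul hN.stepsize_f.tendsto_inv).congr' ?_)
    filter_upwards [eventually_ge_atTop 1] with n hn
    have := (hN.stepsize_a.pos n hn).ne'
    have := (hN.stepsize_f.pos n hn).ne'
    field_simp
  have hρ : 0 ≤ ρ := by
    refine ge_of_tendsto hN.ratio ?_
    filter_upwards [eventually_ge_atTop 1] with n hn
    exact (div_pos (hN.stepsize_f.pos n hn) (hN.stepsize_a.pos n hn)).le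
  have := mul_le_mul_of_nonneg_left hN.mul_lt_f.le hρ
  calc 2 * μ * ξ = μ * ξ + ρ * (μ * η) := by rw [hξ]; ring
    _ < 1 + ρ := by linarith [hN.mul_lt_a]

variable [MeasurableSpace Ω] {P : Measure Ω}

theorem tendsto_recAvg_integral_pair (H : IsSample P X Y g) (hK : IsSecondOrderKernel K)
    (hg : IsRegularAt g x) (hN : IsNormalization stepβ stepγ h m μ ξ η ρ lam θ) (i : Fin 2) :
    Tendsto (fun n => (recAvg (![stepβ, stepγ] i)
        (fun k => ∫ ω, kernelObs K (pairWeight i) h X Y x k ω ∂P) n -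
      weightedMarginal g (pairWeight i) x) / m n) atTop (𝓝 (pairBias K g μ ξ η θ x i)) := by
  have ha := aFun_eq_weightedMarginal hg.one H.density_nonneg
  have hx : ∀ i, TwiceDifferentiableAt (weightedMarginal g (pairWeight i)) x :=
    Fin.forall_fin_two.2 ⟨ha ▸ hg.aFun, marginal_eq_weightedMarginal g ▸ hg.marginal⟩
  convert tendsto_recAvg_integral_kernelObs H hK (hg.isAdmissibleWeight_pairWeight i) (hx i)
    hN.bandwidth hN.gs (hN.isStepsize i) (hN.mul_lt i) hN.bias using 2
  fin_cases i
  · simp [pairBias, pairWeight, ha]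
  · simp [pairBias, pairWeight, marginal_eq_weightedMarginal]

theorem tendsto_recSeq_covariance_pair [IsProbabilityMeasure P] (H : IsSample P X Y g)
    (hK : IsSecondOrderKernel K) (hg : IsRegularAt g x)
    (hN : IsNormalization stepβ stepγ h m μ ξ η ρ lam θ) (i j : Fin 2) :
    Tendsto (fun n => recSeq (fun n => (1 - ![stepβ, stepγ] i n) * (1 - ![stepβ, stepγ] j n))
      (fun n => ![stepβ, stepγ] i n * ![stepβ, stepγ] j n *
        cov[kernelObs K (pairWeight i) h X Y x n, kernelObs K (pairWeight j) h X Y x n; P]) n /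
          m n ^ 2) atTop (𝓝 (pairCov K g μ ξ η ρ lam x i j)) := by
  have hw := hg.isAdmissibleWeight_pairWeight
  have ha := aFun_eq_weightedMarginal hg.one H.density_nonneg
  have hdiag : ∀ {p ξ}, IsStepsize p ξ → Tendsto (fun n => p n / p n) atTop (𝓝 1) :=
    fun {p ξ} hp => tendsto_const_nhds.congr' <| by
      filter_upwards [eventually_ge_atTop 1] with n hn
      rw [div_self (hp.pos n hn).ne']
  have haf := tendsto_recSeq_covariance_kernelObs H hK (hw 0) (hw 1)
    (by simpa [pairWeight, ← ha] using hg.aFun.continuousAt) hN.bandwidth hN.gs hN.stepsize_a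
    hN.stepsize_f.tendsto_zero hN.ratio hN.two_mul_lt hN.tendsto_noise_f
  have haa := tendsto_recSeq_covariance_kernelObs H hK (hw 0) (hw 0)
    (by simpa [pairWeight, sq] using hg.continuousAt_sq) hN.bandwidth hN.gs hN.stepsize_a
    hN.stepsize_a.tendsto_zero (hdiag hN.stepsize_a) (by linarith [hN.mul_lt_a]) hN.noise
  have hff := tendsto_recSeq_covariance_kernelObs H hK (hw 1) (hw 1)
    (by simpa [pairWeight, ← marginal_eq_weightedMarginal] using hg.marginal.continuousAt)
    hN.bandwidth hN.gs hN.stepsize_f hN.stepsize_f.tendsto_zero (hdiag hN.stepsize_f)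
    (by linarith [hN.mul_lt_f]) hN.tendsto_noise_f
  fin_cases i <;> fin_cases j
  · simpa [pairCov, pairWeight, sq] using haa
  · simpa [pairCov, pairWeight, ha] using haf
  · simpa [pairCov, pairWeight, ha, mul_comm, covariance_comm] using haf
  · simpa [pairCov, pairWeight, marginal_eq_weightedMarginal] using hff

end Estimators

section Ratio

variable {Ω : Type*} [MeasurableSpace Ω] {P : Measure Ω} {X Y : ℕ → Ω → ℝ} {g : ℝ → ℝ → ℝ}
  {K φ : ℝ → ℝ} {stepβ stepγ h m p : ℕ → ℝ} {x μ ξ η ρ lam θ : ℝ}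

theorem measurable_recAvg_kernelObs (H : IsSample P X Y g) (hK : Measurable K) (hφ : Measurable φ)
    (n : ℕ) : Measurable fun ω => recAvg p (fun k => kernelObs K φ h X Y x k ω) n := by
  simp only [recAvg_eq_sum]
  exact Finset.measurable_fun_sum _ fun k _ =>
    (measurable_kernelObs H k.succ_pos hK hφ).const_mul _

variable [IsProbabilityMeasure P]

theorem tendstoInDistribution_sum_pair (H : IsSample P X Y g) (hK : IsSecondOrderKernel K)
    (hg : IsRegularAt g x) (hN : IsNormalization stepβ stepγ h m μ ξ η ρ lam θ) (c : Fin 2 → ℝ) :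
    TendstoInDistribution (fun n ω => (m n)⁻¹ * (c 0 * (aEst K stepβ h X Y x n ω - aFun g x) +
        c 1 * (fEst K stepγ h X x n ω - marginal g x))) atTop id (fun _ => P)
      (gaussianReal (∑ i, c i * pairBias K g μ ξ η θ x i)
        (∑ i, ∑ j, c i * c j * pairCov K g μ ξ η ρ lam x i j).toNNReal) := by
  have hclt := tendstoInDistribution_sum_recAvg_kernelObs H hK hg.isAdmissibleWeight_pairWeight
    hN.bandwidth_pos hN.bandwidth hN.gs hN.tendsto_zero hN.isStepsize hN.mul_lt hN.tendsto_noise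
    (tendsto_recSeq_covariance_pair H hK hg hN) (tendsto_recAvg_integral_pair H hK hg hN) c
  simp_rw [aEst_eq_recAvg, fEst_eq_recAvg K stepγ h X Y,
    aFun_eq_weightedMarginal hg.one H.density_nonneg, marginal_eq_weightedMarginal]
  simp only [Fin.sum_univ_two (f := fun _ => _ * (recAvg _ _ _ - _))] at hclt
  exact hclt

theorem ratioVar_nonneg (H : IsSample P X Y g) (hK : IsSecondOrderKernel K)
    (hg : IsRegularAt g x) (hN : IsNormalization stepβ stepγ h m μ ξ η ρ lam θ) :
    0 ≤ ratioVar K g μ ξ η ρ lam x :=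
  div_nonneg (sum_sum_nonneg_of_tendsto_recSeq_covariance
    (fun i n => (memLp_kernelObs H n.succ_pos hK (hg.isAdmissibleWeight_pairWeight i)
      (hN.bandwidth_pos _ n.succ_pos)).mono_exponent (by norm_num))
    (tendsto_recSeq_covariance_pair H hK hg hN) _) (sq_nonneg _)

theorem tendstoInMeasure_fEst (H : IsSample P X Y g) (hK : IsSecondOrderKernel K)
    (hg : IsRegularAt g x) (hN : IsNormalization stepβ stepγ h m μ ξ η ρ lam θ) :
    TendstoInMeasure P (fEst K stepγ h X x) atTop (fun _ => marginal g x) := by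
  have hm : Tendsto m atTop (𝓝[≠] 0) := tendsto_nhdsWithin_iff.2 ⟨hN.tendsto_zero, by
    filter_upwards [eventually_ge_atTop 1] with n hn using (hN.gs.1 n hn).ne'⟩
  have hdiff := tendstoInMeasure_zero_of_tendstoInDistribution_inv_mul hm
    (tendstoInDistribution_sum_pair H hK hg hN ![0, 1])
  simp only [Matrix.cons_val_zero, Matrix.cons_val_one, zero_mul, one_mul, zero_add] at hdiff
  simpa only [sub_add_cancel, zero_add] using
    tendstoInMeasure_comp_continuousAt hdiff (continuous_add_const (marginal g x)).continuousAt

theorem tendstoInDistribution_rEst (H : IsSample P X Y g) (hK : IsSecondOrderKernel K)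
    (hg : IsRegularAt g x) (hfx : marginal g x ≠ 0)
    (hN : IsNormalization stepβ stepγ h m μ ξ η ρ lam θ) :
    TendstoInDistribution
      (fun n ω => (m n)⁻¹ * (rEst K stepγ stepβ h X Y x n ω - regFun g x)) atTop id (fun _ => P)
      (gaussianReal (ratioBias K g μ ξ η θ x) (ratioVar K g μ ξ η ρ lam x).toNNReal) := by
  have hlin : ∀ n ω, ratioCoeff g x 0 * (aEst K stepβ h X Y x n ω - aFun g x) +
      ratioCoeff g x 1 * (fEst K stepγ h X x n ω - marginal g x) =
        aEst K stepβ h X Y x n ω - regFun g x * fEst K stepγ h X x n ω := fun n ω => by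
    simp only [ratioCoeff, aFun, Matrix.cons_val_zero, Matrix.cons_val_one]
    ring
  have hclt := tendstoInDistribution_sum_pair H hK hg hN (ratioCoeff g x)
  simp_rw [hlin] at hclt
  have hA : ∀ n, AEMeasurable (aEst K stepβ h X Y x n) P := fun n => by
    rw [aEst_eq_recAvg]
    exact (measurable_recAvg_kernelObs H hK.measurable measurable_id n).aemeasurable
  have hF : ∀ n, AEMeasurable (fEst K stepγ h X x n) P := fun n => by
    rw [fEst_eq_recAvg K stepγ h X Y]
    exact (measurable_recAvg_kernelObs H hK.measurable measurable_const n).aemeasurable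
  have hratio := tendstoInDistribution_mul_div_sub hA hF hfx hclt (tendstoInMeasure_fEst H hK hg hN)
  simp_rw [rEst_eq_div]
  refine tendstoInDistribution_id_of_hasLaw hratio ?_
  convert gaussianReal_div_const HasLaw.id (marginal g x) using 2
  · rw [ratioBias]
  · rw [ratioVar, Real.toNNReal_div' (sq_nonneg _), Real.toNNReal_of_nonneg (sq_nonneg _)]

end Ratio

section Formulas

variable {K : ℝ → ℝ} {g : ℝ → ℝ → ℝ} {a β μ ξ η ρ θ x : ℝ}

theorem ratioBias_bias_zero : ratioBias K g μ ξ η 0 x = 0 := by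
  simp [ratioBias, pairBias, Fin.sum_univ_two]

theorem ratioVar_noise_zero : ratioVar K g μ ξ η ρ 0 x = 0 := by
  simp [ratioVar, pairCov, Fin.sum_univ_two]

theorem ratioBias_eq_mul_biasB (ha : a ≠ 1) :
    ratioBias K g (2 * a) ξ (1 - a)⁻¹ θ x = θ * biasB K g a ξ x := by
  have hη : 1 - 2 * a * (1 - a)⁻¹ = (1 - 3 * a) / (1 - a) := by
    have := sub_ne_zero.2 ha.symm
    field_simp
    ring
  simp only [ratioBias, ratioCoeff, pairBias, biasB, Fin.sum_univ_two, Matrix.cons_val_zero,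
    Matrix.cons_val_one, hη, div_eq_mul_inv, mul_inv, inv_inv]
  ring

theorem ratioVar_eq_varV (ha : a ≠ 1) (hfx : marginal g x ≠ 0) (hξ : (1 - β) * ξ = 0) :
    ratioVar K g ((β - a) / 2) ξ (1 - a)⁻¹ ((1 - a) * ξ) 1 x = varV K g a ξ β x := by
  have ha' := sub_ne_zero.2 ha.symm
  have haf : 1 + (1 - a) * ξ - 2 * ((β - a) / 2) * ξ = 1 := by linear_combination hξ
  have hff : (1 - a) * ξ / (1 + 1 - 2 * ((β - a) / 2) * (1 - a)⁻¹) = (1 - a) * ξ := by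
    rcases mul_eq_zero.1 hξ with hβ | rfl
    · rw [show 1 + 1 - 2 * ((β - a) / 2) * (1 - a)⁻¹ = 1 by
        field_simp
        linear_combination hβ, div_one]
    · simp
  have haa : 1 + 1 - 2 * ((β - a) / 2) * ξ = 2 - (β - a) * ξ := by ring
  simp only [ratioVar, ratioCoeff, pairCov, Fin.sum_univ_two, Matrix.cons_val_zero,
    Matrix.cons_val_one, Matrix.of_apply, Matrix.cons_val', Matrix.cons_val_fin_one, haf, haa,
    one_mul, div_one, mul_div_right_comm ((1 - a) * ξ), hff, varV, condMoment, weightedMarginal,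
    aFun]
  field_simp
  ring

end Formulas

section Normalization

variable {stepβ stepγ h m : ℕ → ℝ} {a β μ ξ lam θ : ℝ}

theorem GS.inv_natCast_mul (hβ : GS stepβ (-β)) :
    GS (fun n : ℕ => ((n : ℝ) * stepβ n)⁻¹) (-(1 - β)) := by
  simpa only [← sub_eq_add_neg] using (GS.natCast.mul hβ).inv

theorem GS.le_one_of_tendsto_inv_natCast_mul (hβ : GS stepβ (-β))
    (hξ : Tendsto (fun n : ℕ => ((n : ℝ) * stepβ n)⁻¹) atTop (𝓝 ξ)) : β ≤ 1 := by
  linarith [hβ.inv_natCast_mul.nonpos_of_tendsto hξ]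

theorem GS.one_sub_mul_eq_zero (hβ : GS stepβ (-β))
    (hξ : Tendsto (fun n : ℕ => ((n : ℝ) * stepβ n)⁻¹) atTop (𝓝 ξ)) : (1 - β) * ξ = 0 := by
  by_cases h0 : ξ = 0
  · rw [h0, mul_zero]
  · rw [neg_eq_zero.1 (hβ.inv_natCast_mul.eq_zero_of_tendsto hξ h0), zero_mul]

theorem GS.inv_mul_pow_five (hβ : GS stepβ (-β)) (hh : GS h (-a)) :
    GS (fun n => (stepβ n)⁻¹ * h n ^ 5) (β - 5 * a) := by
  convert hβ.inv.mul (hh.pow 5) using 1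
  push_cast
  ring

theorem isStepsize_of_eq_mul_inv_natCast {η : ℝ} (hη : 0 < η)
    (hγ : ∀ n : ℕ, 1 ≤ n → stepγ n = η * (n : ℝ)⁻¹) : IsStepsize stepγ η⁻¹ where
  pos n hn := by
    have : (0 : ℝ) < n := by exact_mod_cast hn
    rw [hγ n hn]
    positivity
  tendsto_zero := by
    have hlim := tendsto_inv_atTop_nhds_zero_nat.const_mul η
    rw [mul_zero] at hlim
    refine hlim.congr' ?_
    filter_upwards [eventually_ge_atTop 1] with n hn using (hγ n hn).symm
  tendsto_inv := by
    refine tendsto_const_nhds.congr' ?_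
    filter_upwards [eventually_ge_atTop 1] with n hn
    have : (n : ℝ) ≠ 0 := by positivity
    rw [hγ n hn]
    field_simp

theorem isNormalization_of_GS (hβ : GS stepβ (-β)) (hβ0 : 0 < β) (hh : GS h (-a))
    (ha : a ∈ Set.Ioo 0 1) (hγ : ∀ n : ℕ, 1 ≤ n → stepγ n = (1 - a) * (n : ℝ)⁻¹)
    (hξ : Tendsto (fun n : ℕ => ((n : ℝ) * stepβ n)⁻¹) atTop (𝓝 ξ)) (hm : GS m (-μ))
    (hm0 : Tendsto m atTop (𝓝 0))
    (hnoise : Tendsto (fun n => stepβ n * (h n)⁻¹ / m n ^ 2) atTop (𝓝 lam))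
    (hbias : Tendsto (fun n => h n ^ 2 / m n) atTop (𝓝 θ)) (hμξ : μ * ξ < 1) (hμ : μ < 1 - a) :
    IsNormalization stepβ stepγ h m μ ξ (1 - a)⁻¹ ((1 - a) * ξ) lam θ where
  stepsize_a := ⟨hβ.1, hβ.tendsto_zero (neg_neg_iff_pos.2 hβ0), hξ⟩
  stepsize_f := isStepsize_of_eq_mul_inv_natCast (sub_pos.2 ha.2) hγ
  ratio := by
    refine (hξ.const_mul (1 - a)).congr' ?_
    filter_upwards [eventually_ge_atTop 1] with n hn
    rw [hγ n hn, mul_inv, div_eq_mul_inv, mul_assoc]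
  bandwidth_pos := hh.1
  bandwidth := hh.tendsto_nhdsGT_zero (neg_neg_iff_pos.2 ha.1)
  gs := hm
  tendsto_zero := hm0
  noise := hnoise
  bias := hbias
  mul_lt_a := hμξ
  mul_lt_f := by rwa [← div_eq_mul_inv, div_lt_one (sub_pos.2 ha.2)]

theorem isNormalization_sqrt {c : ℝ} (hβ : GS stepβ (-β)) (hh : GS h (-a)) (ha : a ∈ Set.Ioo 0 1)
    (hγ : ∀ n : ℕ, 1 ≤ n → stepγ n = (1 - a) * (n : ℝ)⁻¹)
    (hξ : Tendsto (fun n : ℕ => ((n : ℝ) * stepβ n)⁻¹) atTop (𝓝 ξ))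
    (hmin : min (2 * a) ((β - a) / 2) * ξ < 1)
    (hc : Tendsto (fun n => (stepβ n)⁻¹ * h n ^ 5) atTop (𝓝 c))
    (hnoise : Tendsto (fun n => stepβ n * (h n)⁻¹) atTop (𝓝 0)) :
    IsNormalization stepβ stepγ h (fun n => √(stepβ n * (h n)⁻¹)) ((β - a) / 2) ξ (1 - a)⁻¹
      ((1 - a) * ξ) 1 √c := by
  have hgs : GS (fun n => stepβ n * (h n)⁻¹) (-(β - a)) := by
    convert hβ.mul hh.inv using 1
    ring
  have hβa : 0 ≤ β - a := neg_nonpos.1 (hgs.nonpos_of_tendsto hnoise)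
  have hβ5a : β - 5 * a ≤ 0 := (hβ.inv_mul_pow_five hh).nonpos_of_tendsto hc
  rw [min_eq_right (by linarith)] at hmin
  refine isNormalization_of_GS hβ (by linarith [ha.1]) hh ha hγ hξ (neg_div 2 (β - a) ▸ hgs.sqrt)
    (by simpa using hnoise.sqrt) ?_ (hc.sqrt.congr' ?_) hmin
    (by linarith [ha.2, hβ.le_one_of_tendsto_inv_natCast_mul hξ])
  · refine tendsto_const_nhds.congr' ?_
    filter_upwards [eventually_ge_atTop 1] with n hn
    rw [Real.sq_sqrt (hgs.1 n hn).le, div_self (hgs.1 n hn).ne']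
  · filter_upwards [eventually_ge_atTop 1] with n hn
    have := hβ.1 n hn
    have := hh.1 n hn
    rw [← Real.sqrt_sq (by positivity : 0 ≤ h n ^ 2), ← Real.sqrt_div (by positivity)]
    congr 1
    field_simp

theorem isNormalization_sq (hβ : GS stepβ (-β)) (hh : GS h (-a)) (ha : a ∈ Set.Ioo 0 1)
    (hγ : ∀ n : ℕ, 1 ≤ n → stepγ n = (1 - a) * (n : ℝ)⁻¹)
    (hξ : Tendsto (fun n : ℕ => ((n : ℝ) * stepβ n)⁻¹) atTop (𝓝 ξ))
    (hmin : min (2 * a) ((β - a) / 2) * ξ < 1)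
    (htop : Tendsto (fun n => (stepβ n)⁻¹ * h n ^ 5) atTop atTop) :
    IsNormalization stepβ stepγ h (fun n => h n ^ 2) (2 * a) ξ (1 - a)⁻¹ ((1 - a) * ξ) 0 1 := by
  have hβ5a : 0 ≤ β - 5 * a := (hβ.inv_mul_pow_five hh).nonneg_of_tendsto_atTop htop
  have ha0 := ha.1
  rw [min_eq_left (by linarith)] at hmin
  have hgs : GS (fun n => h n ^ 2) (-(2 * a)) := by simpa using hh.pow 2
  refine isNormalization_of_GS hβ (by linarith) hh ha hγ hξ hgs (hgs.tendsto_zero (by linarith))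
    (htop.inv_tendsto_atTop.congr' ?_) (tendsto_const_nhds.congr' ?_) hmin
    (by linarith [hβ.le_one_of_tendsto_inv_natCast_mul hξ])
  · filter_upwards [eventually_ge_atTop 1] with n hn
    have := (hβ.1 n hn).ne'
    have := (hh.1 n hn).ne'
    rw [Pi.inv_apply]
    field_simp
  · filter_upwards [eventually_ge_atTop 1] with n hn
    rw [div_self (hgs.1 n hn).ne']

end Normalization

section Assumptions

variable {g : ℝ → ℝ → ℝ} {stepβ h : ℕ → ℝ} {β a ξ x : ℝ}

theorem DensityAssumption.isRegularAt (hg : DensityAssumption g x)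
    (hf2 : TwiceDifferentiableAt (marginal g) x) (ha2 : TwiceDifferentiableAt (aFun g) x) :
    IsRegularAt g x where
  one := by
    obtain ⟨M, hM⟩ := hg.moment_bounded 0 (by norm_num)
    exact ⟨by simpa using hg.moment_integrable 0 (by norm_num), M, fun s => by
      simpa using (le_abs_self _).trans (hM s)⟩
  cube := by
    have h3 : (3 : ℝ) ∈ Set.Icc (2 : ℝ) 3 := ⟨by norm_num, le_rfl⟩
    have hpow : ∀ t : ℝ, |t| ^ (3 : ℝ) = |t| ^ 3 := fun t => by
      rw [← Real.rpow_natCast, Nat.cast_ofNat]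
    have hint := hg.abs_moment_integrable 3 h3
    have hbdd := hg.abs_moment_bounded 3 h3
    simp only [hpow] at hint hbdd
    exact ⟨hint, by simpa only [abs_pow, abs_abs] using hbdd⟩
  continuousAt_sq := hg.moment_continuousAt 2 le_rfl
  marginal := hf2
  aFun := ha2

theorem StepAssumption.min_mul_lt_one (hstep : StepAssumption stepβ h β a)
    (hξ : Tendsto (fun n : ℕ => ((n : ℝ) * stepβ n)⁻¹) atTop (𝓝 ξ)) :
    min (2 * a) ((β - a) / 2) * ξ < 1 := by
  have hpos : ∀ᶠ n : ℕ in atTop, 0 < (n : ℝ) * stepβ n := by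
    filter_upwards [eventually_ge_atTop 1] with n hn
    exact mul_pos (by exact_mod_cast hn) (hstep.gs_step.1 n hn)
  have hξ0 : 0 ≤ ξ := ge_of_tendsto hξ (hpos.mono fun n hn => (inv_pos.2 hn).le)
  obtain ⟨L, hL, hlt⟩ := hstep.lim_step
  set κ := min (2 * a) ((β - a) / 2)
  rcases le_or_gt κ 0 with hκ | hκ
  · linarith [mul_nonpos_of_nonpos_of_nonneg hκ hξ0]
  obtain ⟨l, hκl, hlL⟩ := EReal.lt_iff_exists_real_btwn.1 hlt
  rw [EReal.coe_lt_coe_iff] at hκl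
  have hl : 0 < l := hκ.trans hκl
  have hξl : ξ ≤ l⁻¹ := by
    refine le_of_tendsto hξ ?_
    filter_upwards [hL.eventually_const_lt hlL] with n hn
    exact inv_anti₀ hl (EReal.coe_lt_coe_iff.1 hn).le
  calc κ * ξ ≤ κ * l⁻¹ := by gcongr
    _ < 1 := by rwa [← div_eq_mul_inv, div_lt_one hl]

end Assumptions

section Limits

variable {Ω : Type*} [MeasurableSpace Ω] {P : Measure Ω} [IsProbabilityMeasure P]
  {X Y : ℕ → Ω → ℝ} {g : ℝ → ℝ → ℝ} {K : ℝ → ℝ} {stepβ stepγ h : ℕ → ℝ} {β a ξ x : ℝ}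

theorem varV_nonneg_and_tendstoInDistribution_rEst {c : ℝ} (H : IsSample P X Y g)
    (hK : IsSecondOrderKernel K) (hg : IsRegularAt g x) (hfx : marginal g x ≠ 0)
    (hβ : GS stepβ (-β)) (hh : GS h (-a)) (ha : a ∈ Set.Ioo 0 1)
    (hγ : ∀ n : ℕ, 1 ≤ n → stepγ n = (1 - a) * (n : ℝ)⁻¹)
    (hξ : Tendsto (fun n : ℕ => ((n : ℝ) * stepβ n)⁻¹) atTop (𝓝 ξ))
    (hmin : min (2 * a) ((β - a) / 2) * ξ < 1)
    (hc : Tendsto (fun n => (stepβ n)⁻¹ * h n ^ 5) atTop (𝓝 c))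
    (hnoise : Tendsto (fun n => stepβ n * (h n)⁻¹) atTop (𝓝 0)) :
    0 ≤ varV K g a ξ β x ∧
      TendstoInDistribution
        (fun n ω => √((stepβ n)⁻¹ * h n) * (rEst K stepγ stepβ h X Y x n ω - regFun g x))
        atTop id (fun _ => P)
        (gaussianReal (√c * biasB K g a ξ x) (varV K g a ξ β x).toNNReal) := by
  have hN := isNormalization_sqrt hβ hh ha hγ hξ hmin hc hnoise
  have hvar := ratioVar_eq_varV (K := K) ha.2.ne hfx (hβ.one_sub_mul_eq_zero hξ)
  have hbias : ratioBias K g ((β - a) / 2) ξ (1 - a)⁻¹ √c x = √c * biasB K g a ξ x := by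
    rcases eq_or_ne c 0 with rfl | hc0
    · rw [Real.sqrt_zero, ratioBias_bias_zero, zero_mul]
    · -- a nonzero limit `c` forces `β = 5 a`, so that both scales coincide
      have hβ5a := (hβ.inv_mul_pow_five hh).eq_zero_of_tendsto hc hc0
      rw [show (β - a) / 2 = 2 * a by linarith, ratioBias_eq_mul_biasB ha.2.ne]
  have hscale : ∀ n, (√(stepβ n * (h n)⁻¹))⁻¹ = √((stepβ n)⁻¹ * h n) := fun n => by
    rw [← Real.sqrt_inv, mul_inv, inv_inv]
  have hlim := tendstoInDistribution_rEst H hK hg hfx hN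
  simp only [hscale, hbias, hvar] at hlim
  exact ⟨hvar ▸ ratioVar_nonneg H hK hg hN, hlim⟩

theorem tendstoInMeasure_rEst (H : IsSample P X Y g) (hK : IsSecondOrderKernel K)
    (hg : IsRegularAt g x) (hfx : marginal g x ≠ 0) (hβ : GS stepβ (-β)) (hh : GS h (-a))
    (ha : a ∈ Set.Ioo 0 1) (hγ : ∀ n : ℕ, 1 ≤ n → stepγ n = (1 - a) * (n : ℝ)⁻¹)
    (hξ : Tendsto (fun n : ℕ => ((n : ℝ) * stepβ n)⁻¹) atTop (𝓝 ξ))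
    (hmin : min (2 * a) ((β - a) / 2) * ξ < 1)
    (htop : Tendsto (fun n => (stepβ n)⁻¹ * h n ^ 5) atTop atTop) :
    TendstoInMeasure P
      (fun n ω => (h n ^ 2)⁻¹ * (rEst K stepγ stepβ h X Y x n ω - regFun g x)) atTop
      (fun _ => biasB K g a ξ x) := by
  have hlim := tendstoInDistribution_rEst H hK hg hfx
    (isNormalization_sq hβ hh ha hγ hξ hmin htop)
  simp only [ratioBias_eq_mul_biasB ha.2.ne, one_mul, ratioVar_noise_zero, Real.toNNReal_zero,
    gaussianReal_zero_var] at hlim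
  exact tendstoInMeasure_of_tendstoInDistribution_dirac hlim

end Limits

end SemiRecursive

end

theorem theorem2_general {Ω : Type*} [MeasurableSpace Ω] (P : Measure Ω) [IsProbabilityMeasure P]
    (X Y : ℕ → Ω → ℝ) (g : ℝ → ℝ → ℝ) (hXY : SemiRecursive.IsSample P X Y g)
    (K : ℝ → ℝ) (hK : SemiRecursive.IsSecondOrderKernel K)
    (stepγ stepβ h : ℕ → ℝ) (β a : ℝ) (hβ : SemiRecursive.GS stepβ (-β))
    (hh : SemiRecursive.GS h (-a)) (ha : a ∈ Set.Ioo 0 1)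
    (hγ : ∀ n : ℕ, 1 ≤ n → stepγ n = (1 - a) * (n : ℝ)⁻¹)
    (ξ : ℝ) (hξ : Tendsto (fun n : ℕ => ((n : ℝ) * stepβ n)⁻¹) atTop (𝓝 ξ))
    (hmin : min (2 * a) ((β - a) / 2) * ξ < 1)
    (x : ℝ) (hg : SemiRecursive.IsRegularAt g x) (hfx : SemiRecursive.marginal g x ≠ 0) :
    (∀ c : ℝ,
      Tendsto (fun n : ℕ => (stepβ n)⁻¹ * h n ^ 5) atTop (𝓝 c) →
      Tendsto (fun n : ℕ => stepβ n * (h n)⁻¹) atTop (𝓝 0) →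
      0 ≤ SemiRecursive.varV K g a ξ β x ∧
      TendstoInDistribution
        (fun (n : ℕ) (ω : Ω) => √((stepβ n)⁻¹ * h n) *
          (SemiRecursive.rEst K stepγ stepβ h X Y x n ω - SemiRecursive.regFun g x))
        atTop (id : ℝ → ℝ) (fun _ => P)
        (gaussianReal (√c * SemiRecursive.biasB K g a ξ x)
          (SemiRecursive.varV K g a ξ β x).toNNReal)) ∧
    (Tendsto (fun n : ℕ => (stepβ n)⁻¹ * h n ^ 5) atTop atTop →
      TendstoInMeasure P
        (fun (n : ℕ) (ω : Ω) => (h n ^ 2)⁻¹ *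
          (SemiRecursive.rEst K stepγ stepβ h X Y x n ω - SemiRecursive.regFun g x))
        atTop (fun _ => SemiRecursive.biasB K g a ξ x)) :=
  ⟨fun _ hc hnoise => SemiRecursive.varV_nonneg_and_tendstoInDistribution_rEst hXY hK hg hfx hβ hh
      ha hγ hξ hmin hc hnoise,
    SemiRecursive.tendstoInMeasure_rEst hXY hK hg hfx hβ hh ha hγ hξ hmin⟩

theorem theorem2 {Ω : Type*} [MeasurableSpace Ω] (P : Measure Ω) [IsProbabilityMeasure P]
    (X Y : ℕ → Ω → ℝ) (g : ℝ → ℝ → ℝ) (hXY : SemiRecursive.IsSample P X Y g)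
    (K : ℝ → ℝ) (hK : SemiRecursive.KernelAssumption K)
    (stepγ stepβ h : ℕ → ℝ) (β a : ℝ) (hstep : SemiRecursive.StepAssumption stepβ h β a)
    (hγ : ∀ n : ℕ, 1 ≤ n → stepγ n = (1 - a) * (n : ℝ)⁻¹)
    (ξ : ℝ) (hξ : Tendsto (fun n : ℕ => ((n : ℝ) * stepβ n)⁻¹) atTop (𝓝 ξ))
    (x : ℝ) (hg : SemiRecursive.DensityAssumption g x)
    (hfx : 0 < SemiRecursive.marginal g x)
    (hf2 : SemiRecursive.TwiceDifferentiableAt (SemiRecursive.marginal g) x)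
    (ha2 : SemiRecursive.TwiceDifferentiableAt (SemiRecursive.aFun g) x) :
    (∀ c : ℝ, 0 ≤ c →
      Tendsto (fun n : ℕ => (stepβ n)⁻¹ * h n ^ 5) atTop (𝓝 c) →
      Tendsto (fun n : ℕ => stepβ n * (h n)⁻¹) atTop (𝓝 0) →
      0 ≤ SemiRecursive.varV K g a ξ β x ∧
      TendstoInDistribution
        (fun (n : ℕ) (ω : Ω) => √((stepβ n)⁻¹ * h n) *
          (SemiRecursive.rEst K stepγ stepβ h X Y x n ω - SemiRecursive.regFun g x))
        atTop (id : ℝ → ℝ) (fun _ => P)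
        (gaussianReal (√c * SemiRecursive.biasB K g a ξ x)
          (SemiRecursive.varV K g a ξ β x).toNNReal)) ∧
    (Tendsto (fun n : ℕ => (stepβ n)⁻¹ * h n ^ 5) atTop atTop →
      TendstoInMeasure P
        (fun (n : ℕ) (ω : Ω) => (h n ^ 2)⁻¹ *
          (SemiRecursive.rEst K stepγ stepβ h X Y x n ω - SemiRecursive.regFun g x))
        atTop (fun _ => SemiRecursive.biasB K g a ξ x)) := by
  have hall := theorem2_general P X Y g hXY K hK.isSecondOrderKernel stepγ stepβ h β a hstep.gs_step
    hstep.gs_bandwidth hstep.a_mem hγ ξ hξ (hstep.min_mul_lt_one hξ) x (hg.isRegularAt hf2 ha2)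
    hfx.ne'
  exact ⟨fun c _ => hall.1 c, hall.2⟩
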